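/- Languages are subsets of $\Sigma^*$ with $\Sigma=\{0,1\}$, and a DPTM is a deterministic polynomial-time oracle Turing machine whose polynomial clock is independent of the oracle. Let $\Sigma_0^p=\mathrm{P}$ and, for $i>0$, $\Sigma_i^p=\mathrm{NP}^{\Sigma_{i-1}^p}=\bigcup_{A\in\Sigma_{i-1}^p}\mathrm{NP}^A$ be the levels of the polynomial hierarchy. For classes $\mathcal C,\mathcal D$ of languages, let $\mathrm{P}^{\mathcal C:\mathcal D}$, $\mathrm{P}^{(\mathcal C,\mathcal D)}_{1,1\text{-tt}}$ and $\mathrm{P}^{\mathcal C,\mathcal D}$ be the classes of all languages $L$ for which there are $C\in\mathcal C$, $D\in\mathcal D$ and a DPTM $M$ with oracles $C$ and $D$ that accepts exactly the words of $L$ and that, on every input, (i) for $\mathrm{P}^{\mathcal C:\mathcal D}$: makes at most one query to $C$ followed by at most one query to $D$; (ii) for $\mathrm{P}^{(\mathcal C,\mathcal D)}_{1,1\text{-tt}}$: makes, simultaneously, at most one query to $C$ and at most one query to $D$; (iii) for $\mathrm{P}^{\mathcal C,\mathcal D}$: makes at most one query to $C$ and at most one query to $D$, in arbitrary order. Then: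 1. For all $j,k\ge 0$, $\mathrm{P}^{\Sigma_j^p:\Sigma_k^p}=\mathrm{P}^{\Sigma_k^p:\Sigma_j^p}$. 2. For all $j,k\ge 0$ with $j\ne k$, $\mathrm{P}^{(\Sigma_j^p,\Sigma_k^p)}_{1,1\text{-tt}}=\mathrm{P}^{\Sigma_j^p:\Sigma_k^p}=\mathrm{P}^{\Sigma_j^p,\Sigma_k^p}$. -/

import Mathlib

namespace QueryOrder

/-- Words over the binary alphabet. -/
abbrev Word : Type := List Bool

/-- A complexity class is a collection of sets of words. -/
abbrev ComplexityClass : Type := Set (Set Word)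

/-- The instruction attached to a state of an oracle Turing machine with states `Q`, work tapes
indexed by `K` (tape alphabet `Option Bool`, that is `0`, `1` and the blank `none`), oracles
indexed by `ι`, and `β` as the set of nondeterministic choices offered at each step. -/
inductive Instr (Q K ι β : Type) : Type
  /-- Halt, accepting (`true`) or rejecting (`false`). -/
  | halt (accept : Bool)
  /-- Ask simultaneously every oracle in `S` about the word on its own query tape; erase these
  query tapes and continue in a state that depends on the answers. -/
  | query (S : Finset ι) (next : (ι → Bool) → Q)
  /-- An ordinary step: depending on the scanned symbols and on the choice made, pass to a new
  state; on each work tape write a symbol and then move the head (`none`: no move); on each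
  query tape append at most one bit at the right end. -/
  | step (δ : (K → Option Bool) → β →
      Q × (K → Option Bool × Option Turing.Dir) × (ι → Option Bool))

/-- A multitape oracle Turing machine: finitely many states, finitely many two-way infinite work
tapes, and one write-only query tape for each oracle. The choice set `β` is `Unit` for a
deterministic machine and `Bool` for a nondeterministic one. -/
structure Machine (ι β : Type) where
  /-- The states. -/
  Q : Type
  /-- The work tapes. -/
  K : Type
  finQ : Finite Q
  finK : Finite K
  /-- The initial state. -/
  start : Q
  /-- The work tape that initially holds the input. -/
  inp : K
  /-- The transition table. -/
  prog : Q → Instr Q K ι β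

namespace Machine

variable {ι β : Type} (M : Machine ι β)

/-- A configuration: the state, the work tapes with their heads, and the query tapes. -/
structure Cfg where
  /-- The current state. -/
  state : M.Q
  /-- The work tapes. -/
  tape : M.K → Turing.Tape (Option Bool)
  /-- The words on the query tapes. -/
  qtape : ι → Word

open scoped Classical in
/-- The initial configuration: the input tape holds `x` with the head on its first symbol, and
all other tapes are empty. -/
noncomputable def init (x : Word) : M.Cfg where
  state := M.start
  tape k := if k = M.inp then Turing.Tape.mk₁ (x.map some) else Turing.Tape.mk₁ []
  qtape _ := []

open scoped Classical in
/-- One step with oracles `O` and nondeterministic choice `b`. Halting configurations stay as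
they are. An oracle that is not asked contributes the constant answer `false`. -/
noncomputable def next (O : ι → Set Word) (b : β) (c : M.Cfg) : M.Cfg :=
  match M.prog c.state with
  | .halt _ => c
  | .query S nxt =>
    { state := nxt fun i => decide (i ∈ S ∧ c.qtape i ∈ O i)
      tape := c.tape
      qtape := fun i => if i ∈ S then [] else c.qtape i }
  | .step δ =>
    let r := δ (fun k => (c.tape k).head) b
    { state := r.1
      tape := fun k =>
        let t := (c.tape k).write (r.2.1 k).1
        match (r.2.1 k).2 with
        | none => t
        | some d => t.move d
      qtape := fun i => c.qtape i ++ (r.2.2 i).toList }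

/-- The configuration after `t` steps of the computation with oracles `O` and input `x` whose
`n`-th step makes the choice `w n`. -/
noncomputable def run (O : ι → Set Word) (w : ℕ → β) (x : Word) : ℕ → M.Cfg
  | 0 => M.init x
  | t + 1 => M.next O (w t) (run O w x t)

/-- Polynomial time: a polynomial clock, independent of the oracles, bounds the length of
every computation. -/
def PolyTime : Prop :=
  ∃ p : Polynomial ℕ, ∀ (O : ι → Set Word) (w : ℕ → β) (x : Word),
    ∃ t ≤ p.eval x.length, ∃ a, M.prog (M.run O w x t).state = .halt a

/-- The language accepted with oracles `O`: the words on which some computation accepts (a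
deterministic machine, `β = Unit`, has exactly one computation). -/
def lang (O : ι → Set Word) : Set Word :=
  {x | ∃ (w : ℕ → β) (t : ℕ), M.prog (M.run O w x t).state = .halt true}

/-- In step `t` (counted from `0`) the computation asks oracle `i`. -/
def AsksAt (O : ι → Set Word) (w : ℕ → β) (x : Word) (t : ℕ) (i : ι) : Prop :=
  ∃ S nxt, M.prog (M.run O w x t).state = .query S nxt ∧ i ∈ S

/-- On every computation each oracle is asked at most once. -/
def AtMostOneEach (O : ι → Set Word) : Prop :=
  ∀ w x i t t', M.AsksAt O w x t i → M.AsksAt O w x t' i → t = t'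

end Machine

/-- A deterministic polynomial-time Turing machine with two oracles, numbered `0` and `1`. -/
structure DPTM extends Machine (Fin 2) Unit where
  polyTime : toMachine.PolyTime

/-- With oracles `A` and `B`, the machine makes at most one query to `A` followed by at most one
query to `B`. -/
def DPTM.IsOrdered (M : DPTM) (A B : Set Word) : Prop :=
  M.AtMostOneEach ![A, B] ∧
    ∀ w x t t', M.AsksAt ![A, B] w x t 0 → M.AsksAt ![A, B] w x t' 1 → t < t'

/-- With oracles `A` and `B`, the machine makes simultaneously at most one query to `A` and at
most one query to `B`: there is at most one querying step, which may ask both. -/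
def DPTM.IsParallel (M : DPTM) (A B : Set Word) : Prop :=
  ∀ w x t t' i i', M.AsksAt ![A, B] w x t i → M.AsksAt ![A, B] w x t' i' → t = t'

/-- With oracles `A` and `B`, the machine makes at most one query to `A` and at most one query
to `B`, one after the other in arbitrary order. -/
def DPTM.IsArbitrary (M : DPTM) (A B : Set Word) : Prop :=
  M.AtMostOneEach ![A, B] ∧
    ∀ w x t t', M.AsksAt ![A, B] w x t 0 → M.AsksAt ![A, B] w x t' 1 → t ≠ t'

/-- The class `P^{C:D}`: one query to `C` followed by one query to `D`. -/
def POrdered (C D : ComplexityClass) : ComplexityClass :=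
  {L | ∃ A ∈ C, ∃ B ∈ D, ∃ M : DPTM, M.IsOrdered A B ∧ L = M.lang ![A, B]}

/-- The class `P_{1,1-tt}^{(C,D)}`: one query to `C` and one query to `D` in parallel. -/
def PParallel (C D : ComplexityClass) : ComplexityClass :=
  {L | ∃ A ∈ C, ∃ B ∈ D, ∃ M : DPTM, M.IsParallel A B ∧ L = M.lang ![A, B]}

/-- The class `P^{C,D}`: one query to `C` and one query to `D` in arbitrary order. -/
def PArbitrary (C D : ComplexityClass) : ComplexityClass :=
  {L | ∃ A ∈ C, ∃ B ∈ D, ∃ M : DPTM, M.IsArbitrary A B ∧ L = M.lang ![A, B]}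

/-- The class `P`, by deterministic machines without oracles. -/
def classP : ComplexityClass :=
  {L | ∃ M : Machine Empty Unit, M.PolyTime ∧ L = M.lang fun i => i.elim}

/-- The class `NP^A`, by nondeterministic machines with the single oracle `A`, which may be asked
arbitrarily often. -/
def classNP (A : Set Word) : ComplexityClass :=
  {L | ∃ M : Machine Unit Bool, M.PolyTime ∧ L = M.lang fun _ => A}

/-- The levels `Σ_k^p` of the polynomial hierarchy: `Σ_0^p = P`, and `Σ_{k+1}^p` is the union of
the classes `NP^A` over all `A` in `Σ_k^p`. -/
def sigma : ℕ → ComplexityClass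
  | 0 => classP
  | k + 1 => {L | ∃ A ∈ sigma k, L ∈ classNP A}

end QueryOrder

/-! Let `POneEach` allow at most one query to each oracle with no condition on timing. It contains
the ordered and the arbitrary-order class, and a parallel pair of queries can be serialized, so
parallel ⊆ ordered ⊆ arbitrary ⊆ `POneEach`. For distinct levels everything follows from `POneEach`
⊆ parallel (`POneEach_sigma_subset_PParallel`). Both extreme classes are symmetric under exchanging
the oracles, so `j < k` may be assumed; in the first claim the remaining case `j = k` is trivial.

Let `M` query `A ∈ Σ_j` and `B ∈ Σ_k = NP^D`, where `D ∈ Σ_{k-1}`. For `i = 0, 1` let `aᵢ` be the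
verdict on `x` when queries to the second oracle are answered by `i` and `A` answers truthfully
(`const`). If the true run gets a positive answer from `B`, its verdict is `a₁`; if the answer is
negative or `B` is not asked, it is `a₀`. Let `W` be the set of `x` such that `a₀ ≠ a₁` and `M` asks
its second oracle about a word of `B`. Then `x ∈ L` iff `a₀ xor [x ∈ W]`.

The gain is that `W` is asked about the input `x` itself, whatever `A` answers. Computing `a₀` takes
at most one query to `A`, and the question `x ∈ W` can be put in the same step (`parallelize`).

It remains to see that `W ∈ Σ_k`. Since `j ≤ k - 1`, the disjoint union `E` of `A` and `D` lies in
`Σ_{k-1}` (`join_mem_sigma`). With oracle `E` one computes `a₀ xor a₁` deterministically, runs `M`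
with `A` up to its first query to the second oracle (`probe`), and then runs the NP machine for `B`
on the query word (`secondQuery`). Both conditions occur positively, so their conjunction is in
`NP^E`.

Most of the remaining work is the construction of concrete machines; the simulation principle
`Machine.simulate` carries time bounds and verdicts from one to another. -/

namespace QueryOrder

/-- Write a symbol, then move. -/
def tapeAct (t : Turing.Tape (Option Bool)) (a : Option Bool × Option Turing.Dir) :
    Turing.Tape (Option Bool) :=
  match a.2 with
  | none => t.write a.1
  | some d => (t.write a.1).move d

theorem tapeAct_idle (t : Turing.Tape (Option Bool)) : tapeAct t (t.head, none) = t :=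
  Turing.Tape.write_self t

theorem tapeAct_move (t : Turing.Tape (Option Bool)) (d : Turing.Dir) :
    tapeAct t (t.head, some d) = t.move d := by
  change (t.write t.head).move d = t.move d
  rw [Turing.Tape.write_self]

/-! ### Halting, verdicts and simulation of computations -/

namespace Machine

variable {ι β : Type} (M : Machine ι β)

theorem next_halt {O : ι → Set Word} {b : β} {c : M.Cfg} {a : Bool}
    (h : M.prog c.state = .halt a) : M.next O b c = c := by
  simp only [next, h]

open scoped Classical in
theorem next_query {O : ι → Set Word} {b : β} {c : M.Cfg} {S : Finset ι} {nxt : (ι → Bool) → M.Q}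
    (h : M.prog c.state = .query S nxt) :
    M.next O b c = ⟨nxt fun i => decide (i ∈ S ∧ c.qtape i ∈ O i), c.tape,
      fun i => if i ∈ S then [] else c.qtape i⟩ := by
  simp only [next, h]

theorem next_step {O : ι → Set Word} {b : β} {c : M.Cfg}
    {δ : (M.K → Option Bool) → β → M.Q × (M.K → Option Bool × Option Turing.Dir) × (ι → Option Bool)}
    (h : M.prog c.state = .step δ) :
    M.next O b c = ⟨(δ (fun k => (c.tape k).head) b).1,
      fun k => tapeAct (c.tape k) ((δ (fun k => (c.tape k).head) b).2.1 k),
      fun i => c.qtape i ++ ((δ (fun k => (c.tape k).head) b).2.2 i).toList⟩ := by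
  simp only [next, h]
  rfl

/-- The configuration is halting. -/
def Halted (c : M.Cfg) : Prop := ∃ a, M.prog c.state = .halt a

variable {M} in
theorem Halted.next_eq {O : ι → Set Word} {b : β} {c : M.Cfg} (h : M.Halted c) :
    M.next O b c = c := M.next_halt h.choose_spec

/-- The configuration `t` steps after `c`. -/
noncomputable def runFrom (O : ι → Set Word) (w : ℕ → β) (c : M.Cfg) : ℕ → M.Cfg
  | 0 => c
  | t + 1 => M.next O (w t) (runFrom O w c t)

theorem runFrom_init (O : ι → Set Word) (w : ℕ → β) (x : Word) (t : ℕ) :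
    M.runFrom O w (M.init x) t = M.run O w x t := by
  induction t with
  | zero => rfl
  | succ t ih => simp only [runFrom, run, ih]

theorem runFrom_succ' (O : ι → Set Word) (w : ℕ → β) (c : M.Cfg) (t : ℕ) :
    M.runFrom O w c (t + 1) = M.runFrom O (fun n => w (n + 1)) (M.next O (w 0) c) t := by
  induction t with
  | zero => rfl
  | succ t ih => rw [runFrom, ih]; rfl

variable {M} in
theorem Halted.runFrom_eq {O : ι → Set Word} {w : ℕ → β} {c : M.Cfg} (h : M.Halted c) (t : ℕ) :
    M.runFrom O w c t = c := by
  induction t with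
  | zero => rfl
  | succ t ih => rw [runFrom, ih, h.next_eq]

/-- Every computation from `c` halts within `n` steps. -/
def HaltsIn (O : ι → Set Word) : ℕ → M.Cfg → Prop
  | 0, c => M.Halted c
  | n + 1, c => M.Halted c ∨ ∀ b, HaltsIn O n (M.next O b c)

variable {M} in
theorem Halted.haltsIn {O : ι → Set Word} {c : M.Cfg} (h : M.Halted c) (n : ℕ) :
    M.HaltsIn O n c := by
  cases n with
  | zero => exact h
  | succ n => exact Or.inl h

variable {M} in
theorem HaltsIn.succ {O : ι → Set Word} {n : ℕ} {c : M.Cfg} (h : M.HaltsIn O n c) :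
    M.HaltsIn O (n + 1) c := by
  induction n generalizing c with
  | zero => exact Or.inl h
  | succ n ih => exact h.imp id fun h b => ih (h b)

variable {M} in
theorem HaltsIn.mono {O : ι → Set Word} {n m : ℕ} {c : M.Cfg} (h : M.HaltsIn O n c)
    (hnm : n ≤ m) : M.HaltsIn O m c := by
  induction hnm with
  | refl => exact h
  | step _ ih => exact ih.succ

/-- The recursive form branches at the first step and so suits inductions along a simulation; the
clock in `PolyTime` speaks of whole choice sequences. The two are matched by prepending a choice to
a sequence. -/
theorem haltsIn_iff [Nonempty β] {O : ι → Set Word} {n : ℕ} {c : M.Cfg} :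
    M.HaltsIn O n c ↔ ∀ w : ℕ → β, ∃ t ≤ n, M.Halted (M.runFrom O w c t) := by
  induction n generalizing c with
  | zero =>
    constructor
    · exact fun h w => ⟨0, le_rfl, h⟩
    · intro h
      obtain ⟨t, ht, h⟩ := h fun _ => Classical.arbitrary β
      obtain rfl := Nat.le_zero.1 ht
      exact h
  | succ n ih =>
    constructor
    · rintro (h | h) w
      · exact ⟨0, Nat.zero_le _, h⟩
      · obtain ⟨t, ht, h⟩ := ih.1 (h (w 0)) fun n => w (n + 1)
        exact ⟨t + 1, Nat.succ_le_succ ht, by rwa [runFrom_succ']⟩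
    · intro h
      by_cases hc : M.Halted c
      · exact Or.inl hc
      · refine Or.inr fun b => ih.2 fun w => ?_
        obtain ⟨t, ht, h⟩ := h fun n => Nat.casesOn n b w
        cases t with
        | zero => exact absurd h hc
        | succ t => exact ⟨t, Nat.le_of_succ_le_succ ht, by rwa [runFrom_succ'] at h⟩

theorem polyTime_iff [Nonempty β] :
    M.PolyTime ↔ ∃ p : Polynomial ℕ, ∀ O x, M.HaltsIn O (p.eval x.length) (M.init x) := by
  simp only [PolyTime, haltsIn_iff, runFrom_init, Halted]
  exact exists_congr fun p => ⟨fun h O x w => h O w x, fun h O w x => h O x w⟩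

/-- Some computation from `c` halts in a configuration with the property `Z`. -/
inductive EndsIn (O : ι → Set Word) (Z : M.Cfg → Prop) : M.Cfg → Prop
  | halt {c : M.Cfg} : M.Halted c → Z c → EndsIn O Z c
  | step {c : M.Cfg} (b : β) : EndsIn O Z (M.next O b c) → EndsIn O Z c

theorem endsIn_of_halted {O : ι → Set Word} {Z : M.Cfg → Prop} {c : M.Cfg} (h : M.Halted c) :
    M.EndsIn O Z c ↔ Z c := by
  refine ⟨fun hc => ?_, .halt h⟩
  induction hc with
  | halt _ hZ => exact hZ
  | step b _ ih => rw [h.next_eq] at ih; exact ih h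

/-- A halting configuration is its own successor, so one may take a step even after the end. -/
theorem endsIn_iff_next [Nonempty β] {O : ι → Set Word} {Z : M.Cfg → Prop} {c : M.Cfg} :
    M.EndsIn O Z c ↔ ∃ b, M.EndsIn O Z (M.next O b c) := by
  refine ⟨fun hc => ?_, fun ⟨b, h⟩ => .step b h⟩
  cases hc with
  | halt h hZ => exact ⟨Classical.arbitrary β, by rw [h.next_eq]; exact .halt h hZ⟩
  | step b h => exact ⟨b, h⟩

theorem endsIn_iff [Nonempty β] {O : ι → Set Word} {Z : M.Cfg → Prop} {c : M.Cfg} :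
    M.EndsIn O Z c ↔ ∃ (w : ℕ → β) (t : ℕ),
      M.Halted (M.runFrom O w c t) ∧ Z (M.runFrom O w c t) := by
  constructor
  · intro h
    induction h with
    | halt h hZ => exact ⟨fun _ => Classical.arbitrary β, 0, h, hZ⟩
    | step b _ ih =>
      obtain ⟨w, t, h, hZ⟩ := ih
      refine ⟨fun n => Nat.casesOn n b w, t + 1, ?_⟩
      rw [runFrom_succ']
      exact ⟨h, hZ⟩
  · rintro ⟨w, t, h, hZ⟩
    induction t generalizing c w with
    | zero => exact .halt h hZ
    | succ t ih =>
      rw [runFrom_succ'] at h hZ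
      exact .step (w 0) (ih _ h hZ)

variable {M} in
theorem EndsIn.imp {O : ι → Set Word} {Z Z' : M.Cfg → Prop} {c : M.Cfg} (h : M.EndsIn O Z c)
    (hZ : ∀ c, M.Halted c → Z c → Z' c) : M.EndsIn O Z' c := by
  induction h with
  | halt h h' => exact .halt h (hZ _ h h')
  | step b _ ih => exact .step b ih

/-- Some computation from `c` halts with the verdict `v`. -/
def Yields (O : ι → Set Word) (v : Bool) (c : M.Cfg) : Prop :=
  M.EndsIn O (fun c => M.prog c.state = .halt v) c

theorem yields_of_halt {O : ι → Set Word} {v a : Bool} {c : M.Cfg}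
    (h : M.prog c.state = .halt a) : M.Yields O v c ↔ v = a := by
  rw [Yields, endsIn_of_halted M ⟨a, h⟩, h, Instr.halt.injEq, eq_comm]

theorem mem_lang_iff [Nonempty β] {O : ι → Set Word} {x : Word} :
    x ∈ M.lang O ↔ M.Yields O true (M.init x) := by
  simp only [lang, Set.mem_ofPred_eq, Yields, endsIn_iff, runFrom_init]
  exact exists₂_congr fun w t => ⟨fun h => ⟨⟨_, h⟩, h⟩, fun h => h.2⟩

/-- After `n` steps, every computation from `c` is in the configuration `c'`. -/
def Leads (O : ι → Set Word) : ℕ → M.Cfg → M.Cfg → Prop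
  | 0, c, c' => c = c'
  | n + 1, c, c' => ∀ b, Leads O n (M.next O b c) c'

variable {M} in
theorem Leads.endsIn_iff [Nonempty β] {O : ι → Set Word} {Z : M.Cfg → Prop} {n : ℕ}
    {c c' : M.Cfg} (h : M.Leads O n c c') : M.EndsIn O Z c ↔ M.EndsIn O Z c' := by
  induction n generalizing c with
  | zero => rw [show c = c' from h]
  | succ n ih =>
    rw [endsIn_iff_next, exists_congr fun b => ih (h b)]
    simp

variable {M} in
theorem Leads.haltsIn {O : ι → Set Word} {n m : ℕ} {c c' : M.Cfg} (h : M.Leads O n c c')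
    (hc : M.HaltsIn O m c') : M.HaltsIn O (m + n) c := by
  induction n generalizing c with
  | zero => rw [show c = c' from h]; exact hc
  | succ n ih => exact Or.inr fun b => ih (h b)

/-- `M'` simulates `M` along the relation `R` between configurations, with at most `d` steps for
each step of `M` and at most `T` steps when `M` has halted. -/
theorem simulate {ι' β' : Type} [Nonempty β] [Nonempty β'] {M : Machine ι β} {M' : Machine ι' β'}
    {O : ι → Set Word} {O' : ι' → Set Word} (R : M.Cfg → M'.Cfg → Prop) (d T : ℕ)
    {Z : M'.Cfg → Prop} (V : M.Cfg → Prop)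
    (hstep : ∀ c c', R c c' → ¬ M.Halted c →
      (∀ b', ∃ b c'', ∃ k < d, M'.Leads O' k (M'.next O' b' c') c'' ∧ R (M.next O b c) c'') ∧
      ∀ b, ∃ b' c'', ∃ k < d, M'.Leads O' k (M'.next O' b' c') c'' ∧ R (M.next O b c) c'')
    {n : ℕ} {c : M.Cfg} {c' : M'.Cfg} (hn : M.HaltsIn O n c) (hR : R c c')
    (hhalt : ∀ cf cf', M.Halted cf → M.EndsIn O (· = cf) c → R cf cf' →
      M'.HaltsIn O' T cf' ∧ (M'.EndsIn O' Z cf' ↔ V cf)) :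
    M'.HaltsIn O' (d * n + T) c' ∧ (M'.EndsIn O' Z c' ↔ M.EndsIn O V c) := by
  induction n generalizing c c' with
  | zero =>
    have hc : M.Halted c := hn
    have := hhalt c c' hc (.halt hc rfl) hR
    rw [endsIn_of_halted M hc]
    exact ⟨this.1.mono (by omega), this.2⟩
  | succ n ih =>
    by_cases hc : M.Halted c
    · have := hhalt c c' hc (.halt hc rfl) hR
      rw [endsIn_of_halted M hc]
      exact ⟨this.1.mono (by omega), this.2⟩
    · have hn' := hn.resolve_left hc
      obtain ⟨h1, h2⟩ := hstep c c' hR hc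
      -- The `- 1` accounts for the step of `M'` already made; the `k < d` steps after it do not
      -- depend on choices.
      have key : ∀ b b' c'' k, k < d → M'.Leads O' k (M'.next O' b' c') c'' →
          R (M.next O b c) c'' → M'.HaltsIn O' (d * (n + 1) + T - 1) (M'.next O' b' c') ∧
          (M'.EndsIn O' Z (M'.next O' b' c') ↔ M.EndsIn O V (M.next O b c)) := by
        intro b b' c'' k hk hL hR'
        obtain ⟨i1, i2⟩ := ih (hn' b) hR' fun cf cf' hcf he => hhalt cf cf' hcf (.step b he)
        refine ⟨(hL.haltsIn i1).mono ?_, hL.endsIn_iff.trans i2⟩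
        rw [Nat.mul_succ]; omega
      -- Positivity of `d` makes the subtraction above genuine.
      have hd : 0 < d := by
        obtain ⟨_, _, k, hk, _⟩ := h2 (Classical.arbitrary β)
        omega
      constructor
      · have : d * (n + 1) + T = (d * (n + 1) + T - 1) + 1 := by
          rw [Nat.mul_succ]; omega
        rw [this]
        refine Or.inr fun b' => ?_
        obtain ⟨b, c'', k, hk, hL, hR'⟩ := h1 b'
        exact (key b b' c'' k hk hL hR').1
      · rw [endsIn_iff_next, endsIn_iff_next (M := M)]
        constructor
        · rintro ⟨b', h⟩
          obtain ⟨b, c'', k, hk, hL, hR'⟩ := h1 b'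
          exact ⟨b, (key b b' c'' k hk hL hR').2.1 h⟩
        · rintro ⟨b, h⟩
          obtain ⟨b', c'', k, hk, hL, hR'⟩ := h2 b
          exact ⟨b', (key b b' c'' k hk hL hR').2.2 h⟩

/-- Simulation of a machine by another one with the same nondeterministic choices. -/
theorem simulate_choice {ι' : Type} [Nonempty β] {M : Machine ι β} {M' : Machine ι' β}
    {O : ι → Set Word} {O' : ι' → Set Word} (e : M.Cfg → M'.Cfg) (d T : ℕ)
    {Z : M'.Cfg → Prop} (V : M.Cfg → Prop)
    (hstep : ∀ c, ¬ M.Halted c → ∀ b, ∃ k < d,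
      M'.Leads O' k (M'.next O' b (e c)) (e (M.next O b c)))
    {n : ℕ} {c : M.Cfg} (hn : M.HaltsIn O n c)
    (hhalt : ∀ cf, M.Halted cf → M.EndsIn O (· = cf) c →
      M'.HaltsIn O' T (e cf) ∧ (M'.EndsIn O' Z (e cf) ↔ V cf)) :
    M'.HaltsIn O' (d * n + T) (e c) ∧ (M'.EndsIn O' Z (e c) ↔ M.EndsIn O V c) := by
  refine simulate (fun c c' => c' = e c) d T V ?_ hn rfl ?_
  · rintro c _ rfl hc
    have key : ∀ b, ∃ b' c'', ∃ k < d,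
        M'.Leads O' k (M'.next O' b' (e c)) c'' ∧ c'' = e (M.next O b c) := fun b => by
      obtain ⟨k, hk, h⟩ := hstep c hc b
      exact ⟨b, _, k, hk, h, rfl⟩
    refine ⟨fun b => ?_, key⟩
    obtain ⟨k, hk, h⟩ := hstep c hc b
    exact ⟨b, _, k, hk, h, rfl⟩
  · rintro cf _ hcf he rfl
    exact hhalt cf hcf he

end Machine

/-! ### Machines containing a copy of another machine -/

section Embedding

open Function

variable {ι β Q Q' K K' : Type}

/-- Rename the states and tapes of an instruction; the new tapes are left alone. -/
noncomputable def Instr.map (g : Q → Q') (f : K → K') : Instr Q K ι β → Instr Q' K' ι β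
  | .halt a => .halt a
  | .query S nxt => .query S fun a => g (nxt a)
  | .step δ => .step fun h b =>
      (g (δ (h ∘ f) b).1, extend f (δ (h ∘ f) b).2.1 fun k => (h k, none), (δ (h ∘ f) b).2.2)

/-- The configuration of a machine that contains another one; `τ` is on the extra tapes. -/
noncomputable def Machine.Cfg.map {M M' : Machine ι β} (g : M.Q → M'.Q) (f : M.K → M'.K)
    (τ : M'.K → Turing.Tape (Option Bool)) (c : M.Cfg) : M'.Cfg :=
  ⟨g c.state, extend f c.tape τ, c.qtape⟩

/-- Tapes outside the range of `f` rewrite the scanned symbol and do not move, so they keep the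
content `τ`; on the range, injectivity of `f` recovers the original tapes. -/
theorem Machine.next_map {M M' : Machine ι β} (g : M.Q → M'.Q) (f : M.K → M'.K)
    (hf : Injective f) (τ : M'.K → Turing.Tape (Option Bool)) (O : ι → Set Word) (b : β)
    (c : M.Cfg) (h : M'.prog (g c.state) = (M.prog c.state).map g f) :
    M'.next O b (c.map g f τ) = (M.next O b c).map g f τ := by
  have h' : M'.prog (c.map g f τ).state = (M.prog c.state).map g f := h
  cases hp : M.prog c.state with
  | halt a =>
    rw [hp] at h'
    rw [M'.next_halt h', M.next_halt hp]
  | query S nxt =>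
    rw [hp] at h'
    rw [M'.next_query h', M.next_query hp]
    rfl
  | step δ =>
    rw [hp] at h'
    rw [M'.next_step h', M.next_step hp]
    have e : (fun k => ((c.map g f τ).tape k).head) ∘ f = fun k => (c.tape k).head := by
      funext k
      simp [Machine.Cfg.map, hf.extend_apply]
    simp only [e]
    simp only [Machine.Cfg.map, Machine.Cfg.mk.injEq, true_and, and_true]
    funext k
    by_cases hk : ∃ k', f k' = k
    · obtain ⟨k', rfl⟩ := hk
      simp only [hf.extend_apply]
    · simp only [extend_apply' _ _ _ hk, tapeAct_idle]

/-- Simulation by a machine that contains a copy of the simulated one. -/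
theorem Machine.simulate_map [Nonempty β] {M M' : Machine ι β} (g : M.Q → M'.Q) (f : M.K → M'.K)
    (hf : Injective f) (τ : M'.K → Turing.Tape (Option Bool)) {O : ι → Set Word} {T : ℕ}
    {Z : M'.Cfg → Prop} (V : M.Cfg → Prop)
    (h : ∀ q, (∀ a, M.prog q ≠ .halt a) → M'.prog (g q) = (M.prog q).map g f)
    {n : ℕ} {c : M.Cfg} (hn : M.HaltsIn O n c)
    (hhalt : ∀ cf, M.Halted cf → M.EndsIn O (· = cf) c →
      M'.HaltsIn O T (cf.map g f τ) ∧ (M'.EndsIn O Z (cf.map g f τ) ↔ V cf)) :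
    M'.HaltsIn O (n + T) (c.map g f τ) ∧ (M'.EndsIn O Z (c.map g f τ) ↔ M.EndsIn O V c) := by
  have := simulate_choice (Z := Z) (Machine.Cfg.map g f τ) 1 T V
    (fun c hc b => ⟨0, one_pos, ?_⟩) hn hhalt
  · rwa [Nat.one_mul] at this
  · exact next_map g f hf τ O b c (h _ fun a ha => hc ⟨a, ha⟩)

/-- Simulation by a machine that contains a copy of the simulated one and gives its verdicts. -/
theorem Machine.yields_map [Nonempty β] {M M' : Machine ι β} (g : M.Q → M'.Q) (f : M.K → M'.K)
    (hf : Injective f) (τ : M'.K → Turing.Tape (Option Bool)) {O : ι → Set Word} {v : Bool}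
    (h : ∀ q, M'.prog (g q) = (M.prog q).map g f)
    {n : ℕ} {c : M.Cfg} (hn : M.HaltsIn O n c) :
    M'.HaltsIn O n (c.map g f τ) ∧ (M'.Yields O v (c.map g f τ) ↔ M.Yields O v c) := by
  refine simulate_map (T := 0) g f hf τ _ (fun q _ => h q) hn fun cf ⟨a, ha⟩ _ => ?_
  have ha' : M'.prog (cf.map g f τ).state = .halt a := by
    rw [show (cf.map g f τ).state = g cf.state from rfl, h, ha]; rfl
  refine ⟨⟨a, ha'⟩, ?_⟩
  rw [endsIn_of_halted M' ⟨a, ha'⟩, ha, ha', Instr.halt.injEq, Instr.halt.injEq]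

end Embedding

end QueryOrder

/-! ### Words on tapes -/

namespace QueryOrder

open Function Turing

theorem eval_monotone (p : Polynomial ℕ) : Monotone fun n => p.eval n := by
  intro m n h
  induction p using Polynomial.induction_on' with
  | add p q hp hq => simpa using Nat.add_le_add hp hq
  | monomial k a => simpa using Nat.mul_le_mul_left a (Nat.pow_le_pow_left h k)

/-- The tape with `r` to the right of the head (the head being on its first symbol) and the
reverse of `l` to the left. -/
def wordTape (l r : Word) : Tape (Option Bool) :=
  Tape.mk' (ListBlank.mk (l.map some)) (ListBlank.mk (r.map some))

theorem wordTape_head_nil (l : Word) : (wordTape l []).head = none := rfl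

theorem wordTape_head_cons (l r : Word) (b : Bool) : (wordTape l (b :: r)).head = some b := rfl

theorem wordTape_move_right (l r : Word) (b : Bool) :
    (wordTape l (b :: r)).move .right = wordTape (b :: l) r := by
  simp [wordTape, Tape.move_right_mk']

theorem wordTape_move_left (l r : Word) (b : Bool) :
    (wordTape (b :: l) r).move .left = wordTape l (b :: r) := by
  simp [wordTape, Tape.move_left_mk']

theorem wordTape_append (l : Word) (b : Bool) :
    ((wordTape l []).write (some b)).move .right = wordTape (b :: l) [] := by
  simp [wordTape, Tape.move_right_mk', Tape.write_mk']

theorem listBlank_mk_none : (ListBlank.mk [none] : ListBlank (Option Bool)) = ListBlank.mk [] :=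
  ListBlank.cons_head_tail (ListBlank.mk [] : ListBlank (Option Bool))

/-- `ListBlank` identifies lists up to trailing blanks, so an erased cell at the left edge leaves no
trace. -/
theorem wordTape_erase (r : Word) (b : Bool) :
    ((wordTape [] (b :: r)).write none).move .right = wordTape [] r := by
  simp [wordTape, Tape.move_right_mk', Tape.write_mk', listBlank_mk_none]

/-- Needed because `branch` lets every tape, not only the input tape, write a blank and move right.
-/
theorem tapeAct_blank : tapeAct (wordTape [] []) (none, some .right) = wordTape [] [] := by
  change ((wordTape [] []).write none).move .right = wordTape [] []
  simp only [wordTape, Tape.move_right_mk', Tape.write_mk', List.map_nil, ListBlank.cons_mk,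
    ListBlank.tail_mk, List.tail_nil]
  exact congrArg (Tape.mk' · _) listBlank_mk_none

theorem wordTape_nil_left_head (r : Word) : ((wordTape [] r).move .left).head = none := by
  simp only [wordTape, Tape.move_left_mk', Tape.mk'_head, ListBlank.head_cons]
  rfl

/-- The loop of `back` writes copies from right to left, with the head always one cell to the left
of the part already written. -/
theorem wordTape_prepend (r : Word) (b : Bool) :
    (((wordTape [] r).move .left).write (some b)).move .left =
      (wordTape [] (b :: r)).move .left := by
  congr 1
  simp [wordTape, Tape.move_left_mk', Tape.write_mk']

namespace Machine

variable {ι β : Type}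

open scoped Classical in
theorem init_eq (M : Machine ι β) (x : Word) :
    M.init x = ⟨M.start, fun k => if k = M.inp then wordTape [] x else wordTape [] [],
      fun _ => []⟩ := rfl

theorem endsIn_exists_halt [Nonempty β] (M : Machine ι β) {O : ι → Set Word} {P : Bool → Prop}
    {c : M.Cfg} :
    M.EndsIn O (fun c => ∃ a, M.prog c.state = .halt a ∧ P a) c ↔ ∃ a, M.Yields O a c ∧ P a := by
  simp only [Yields, endsIn_iff]
  constructor
  · rintro ⟨w, t, h, a, h1, h2⟩
    exact ⟨a, ⟨w, t, h, h1⟩, h2⟩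
  · rintro ⟨a, ⟨w, t, h, h1⟩, h2⟩
    exact ⟨w, t, h, a, h1, h2⟩

/-! ### Rewinding a tape -/

section Back

open scoped Classical in
/-- Move the head of tape `s` back over the word to the left of it, copying this word to the tapes
in `S`; then start `M`. -/
noncomputable abbrev back (M : Machine ι β) (s : M.K) (S : Set M.K) : Machine ι β where
  Q := Bool ⊕ M.Q
  K := M.K
  finQ := by have := M.finQ; infer_instance
  finK := M.finK
  start := .inl false
  inp := M.inp
  prog
    | .inl false => .step fun h _ =>
        (.inl true, fun k => (h k, if k = s ∨ k ∈ S then some .left else none), fun _ => none)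
    | .inl true => .step fun h _ =>
        match h s with
        | some b => (.inl true, fun k => if k = s then (h k, some .left) else
            if k ∈ S then (some b, some .left) else (h k, none), fun _ => none)
        | none => (.inr M.start,
            fun k => (h k, if k = s ∨ k ∈ S then some .right else none), fun _ => none)
    | .inr q => (M.prog q).map .inr id

variable (M : Machine ι β) (s : M.K) (S : Set M.K)

open scoped Classical in
-- Loop invariant: `l` is still to be passed and `r` has been passed and copied; source and target
-- heads stand one cell to the left of `r`. The blank before the word ends the loop, and the extra
-- step moves the heads back onto its first symbol.
theorem back_loop (O : ι → Set Word) (τ : M.K → Tape (Option Bool)) (κ : ι → Word) (l r : Word) :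
    (M.back s S).Leads O (l.length + 1)
      ⟨.inl true, fun k => if k = s then (wordTape l r).move .left else
        if k ∈ S then (wordTape [] r).move .left else τ k, κ⟩
      ⟨.inr M.start, fun k => if k = s ∨ k ∈ S then wordTape [] (l.reverse ++ r) else τ k, κ⟩ := by
  induction l generalizing r with
  | nil =>
    intro b
    rw [(M.back s S).next_step rfl]
    simp only [if_true, wordTape_nil_left_head]
    simp only [Leads, Cfg.mk.injEq, true_and]
    refine ⟨?_, by funext; simp⟩
    funext k
    by_cases h1 : k = s
    · simp only [h1, if_true, true_or, tapeAct_move, Tape.move_left_right]; rfl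
    · by_cases h2 : k ∈ S
      · simp only [h1, h2, if_true, if_false, or_true, tapeAct_move, Tape.move_left_right]; rfl
      · simp only [h1, h2, if_false, or_false, tapeAct_idle]
  | cons a l ih =>
    intro b
    rw [(M.back s S).next_step rfl]
    simp only [if_true, wordTape_move_left, wordTape_head_cons]
    convert ih (a :: r) using 2
    · rfl
    · funext k
      by_cases h1 : k = s
      · simp only [h1, if_true, tapeAct_move]
      · by_cases h2 : k ∈ S
        · simp only [h1, h2, if_true, if_false]
          exact wordTape_prepend r a
        · simp only [h1, h2, if_false, tapeAct_idle]
    · funext; simp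
    · simp [List.append_assoc]

open scoped Classical in
theorem back_spec [Nonempty β] {O : ι → Set Word} {τ : M.K → Tape (Option Bool)} {κ : ι → Word}
    {y : Word} {n : ℕ} {v : Bool} (hs : τ s = wordTape y.reverse [])
    (hS : ∀ k ∈ S, k ≠ s → τ k = wordTape [] [])
    (hn : M.HaltsIn O n ⟨M.start, fun k => if k = s ∨ k ∈ S then wordTape [] y else τ k, κ⟩) :
    (M.back s S).HaltsIn O (n + (y.length + 2)) ⟨.inl false, τ, κ⟩ ∧
      ((M.back s S).Yields O v ⟨.inl false, τ, κ⟩ ↔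
        M.Yields O v ⟨M.start, fun k => if k = s ∨ k ∈ S then wordTape [] y else τ k, κ⟩) := by
  have h1 : (M.back s S).Leads O (y.length + 2) ⟨.inl false, τ, κ⟩
      ⟨.inr M.start, fun k => if k = s ∨ k ∈ S then wordTape [] y else τ k, κ⟩ := by
    intro b
    rw [(M.back s S).next_step rfl]
    have := M.back_loop s S O τ κ y.reverse []
    rw [List.reverse_reverse, List.append_nil, List.length_reverse] at this
    convert this using 2
    · funext k
      by_cases h1 : k = s
      · simp only [h1, true_or, if_true, tapeAct_move, hs]
      · by_cases h2 : k ∈ S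
        · simp only [h1, h2, or_true, if_true, if_false, tapeAct_move, hS k h2 h1]
        · simp only [h1, h2, or_false, if_false, tapeAct_idle]
    · funext; simp
  have h2 := yields_map (M := M) (M' := M.back s S) (v := v) .inr id injective_id
    (fun k => if k = s ∨ k ∈ S then wordTape [] y else τ k) (fun _ => rfl) hn
  simp only [Cfg.map, extend_id] at h2
  exact ⟨h1.haltsIn h2.1, h1.endsIn_iff.trans h2.2⟩

end Back

/-! ### Copying the input -/

section Prep

open scoped Classical in
/-- Copy the input to the tapes in `S` and to the query tapes in `U`; then start `M`. -/
noncomputable abbrev prep (M : Machine ι β) (S : Set M.K) (U : Set ι) : Machine ι β where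
  Q := Option (M.back M.inp S).Q
  K := M.K
  finQ := by have := (M.back M.inp S).finQ; infer_instance
  finK := M.finK
  start := none
  inp := M.inp
  prog
    | none => .step fun h _ =>
        match h M.inp with
        | some b => (none, fun k => (h k, if k = M.inp then some .right else none),
            fun i => if i ∈ U then some b else none)
        | none => (some (M.back M.inp S).start, fun k => (h k, none), fun _ => none)
    | some q => ((M.back M.inp S).prog q).map some id

variable (M : Machine ι β) (S : Set M.K) (U : Set ι)

open scoped Classical in
/-- The initial configuration with input `x` on several tapes. -/
noncomputable def multiInit (x : Word) : M.Cfg :=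
  ⟨M.start, fun k => if k = M.inp ∨ k ∈ S then wordTape [] x else wordTape [] [],
    fun i => if i ∈ U then x else []⟩

open scoped Classical in
-- Query tapes grow only at the right end, so they are filled on this forward pass; work tapes
-- receive their copies on the way back.
theorem prep_loop (O : ι → Set Word) (l r : Word) :
    (M.prep S U).Leads O (r.length + 1)
      ⟨none, fun k => if k = M.inp then wordTape l r else wordTape [] [],
        fun i => if i ∈ U then l.reverse else []⟩
      ⟨some (.inl false),
        fun k => if k = M.inp then wordTape (l.reverse ++ r).reverse [] else wordTape [] [],
        fun i => if i ∈ U then l.reverse ++ r else []⟩ := by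
  induction r generalizing l with
  | nil =>
    intro b
    rw [(M.prep S U).next_step rfl]
    simp only [if_true, wordTape_head_nil, tapeAct_idle]
    simp only [Leads, List.append_nil, List.reverse_reverse, Option.toList_none]
  | cons a r ih =>
    intro b
    rw [(M.prep S U).next_step rfl]
    simp only [if_true, wordTape_head_cons]
    convert ih (a :: l) using 2
    · rfl
    · funext k
      by_cases h1 : k = M.inp
      · simp only [h1, if_true, tapeAct_move, wordTape_move_right]
      · simp only [h1, if_false, tapeAct_idle]
    · funext i
      by_cases h : i ∈ U <;> simp [h]
    · simp
    · simp

theorem prep_spec [Nonempty β] {O : ι → Set Word} {x : Word} {n : ℕ} {v : Bool}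
    (hn : M.HaltsIn O n (M.multiInit S U x)) :
    (M.prep S U).HaltsIn O (n + (2 * x.length + 3)) ((M.prep S U).init x) ∧
      ((M.prep S U).Yields O v ((M.prep S U).init x) ↔ M.Yields O v (M.multiInit S U x)) := by
  classical
  have h1 : (M.prep S U).Leads O (x.length + 1) ((M.prep S U).init x)
      (Cfg.map (M := M.back M.inp S) (M' := M.prep S U) some id
        (fun _ => wordTape [] []) ⟨.inl false,
        fun k => if k = M.inp then wordTape x.reverse [] else wordTape [] [],
        fun i => if i ∈ U then x else []⟩) := by
    have := M.prep_loop S U O [] x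
    simp only [List.reverse_nil, List.nil_append, ite_self] at this
    simp only [Cfg.map, extend_id]
    exact this
  have h0 : M.multiInit S U x = ⟨M.start, fun k => if k = M.inp ∨ k ∈ S then wordTape [] x else
      if k = M.inp then wordTape x.reverse [] else wordTape [] [],
      fun i => if i ∈ U then x else []⟩ := by
    simp only [multiInit, Cfg.mk.injEq, true_and, and_true]
    funext k
    by_cases h1 : k = M.inp
    · simp [h1]
    · by_cases h2 : k ∈ S <;> simp [h1, h2]
  rw [h0] at hn ⊢
  have h2 := M.back_spec M.inp S (v := v) (by simp) (fun k _ hk => by simp [hk]) hn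
  have h3 := yields_map (M := M.back M.inp S) (M' := M.prep S U) (v := v) some id injective_id
    (fun _ => wordTape [] []) (fun _ => rfl) h2.1
  exact ⟨(h1.haltsIn h3.1).mono (by omega), h1.endsIn_iff.trans (h3.2.trans h2.2)⟩

end Prep

/-! ### Prefixing the queries by a bit -/

section Tag

/-- Prefix every query by the bit `b`. -/
abbrev tag (M : Machine Unit β) (b : Bool) : Machine Unit β where
  Q := M.Q × Bool
  K := M.K
  finQ := by have := M.finQ; infer_instance
  finK := M.finK
  start := (M.start, true)
  inp := M.inp
  prog
    | (q, true) => .step fun h _ => ((q, false), fun k => (h k, none), fun _ => some b)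
    | (q, false) =>
      match M.prog q with
      | .halt a => .halt a
      | .query S nxt => .query S fun a => (nxt a, decide (() ∈ S))
      | .step δ => .step fun h c => (((δ h c).1, false), (δ h c).2)

variable (M : Machine Unit β) (b : Bool)

/-- The configuration of `M.tag b` that corresponds to a configuration of `M`. -/
def tagCfg (c : M.Cfg) : (M.tag b).Cfg := ⟨(c.state, false), c.tape, fun i => b :: c.qtape i⟩

/-- The flag `true` means that the prefix bit is still to be written. This happens at the start and
after each real query, since a query erases its tape. -/
theorem tag_pending (O : Unit → Set Word) (q : M.Q) (τ : M.K → Tape (Option Bool)) :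
    (M.tag b).Leads O 1 ⟨(q, true), τ, fun _ => []⟩ (M.tagCfg b ⟨q, τ, fun _ => []⟩) := by
  intro _
  rw [(M.tag b).next_step rfl]
  simp only [tapeAct_idle]
  rfl

theorem tag_step [Nonempty β] (O : Unit → Set Word) (c : M.Cfg) (hc : ¬ M.Halted c) (d : β) :
    ∃ k < 2, (M.tag b).Leads O k ((M.tag b).next O d (M.tagCfg b c))
      (M.tagCfg b (M.next (fun i => {x | b :: x ∈ O i}) d c)) := by
  classical
  cases hp : M.prog c.state with
  | halt a => exact absurd ⟨a, hp⟩ hc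
  | query S nxt =>
    have hp' : (M.tag b).prog (M.tagCfg b c).state =
        .query S fun a => (nxt a, decide (() ∈ S)) := by
      simp only [tag, tagCfg, hp]
    rw [(M.tag b).next_query hp', M.next_query hp]
    by_cases hS : () ∈ S
    · refine ⟨1, by omega, ?_⟩
      have := M.tag_pending b O (nxt fun i => decide (i ∈ S ∧ b :: c.qtape i ∈ O i)) c.tape
      simp only [hS, true_and, if_true, decide_true] at this ⊢
      exact this
    · refine ⟨0, by omega, ?_⟩
      simp only [hS, false_and, if_false, decide_false]
      rfl
  | step δ =>
    have hp' : (M.tag b).prog (M.tagCfg b c).state =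
        .step fun h c => (((δ h c).1, false), (δ h c).2) := by
      simp only [tag, tagCfg, hp]
    refine ⟨0, by omega, ?_⟩
    rw [(M.tag b).next_step hp', M.next_step hp]
    rfl

theorem tag_spec [Nonempty β] {O : Unit → Set Word} {Z : (M.tag b).Cfg → Prop} {n : ℕ} {x : Word}
    (hn : M.HaltsIn (fun i => {x | b :: x ∈ O i}) n (M.init x)) :
    (M.tag b).HaltsIn O (2 * n + 1) ((M.tag b).init x) ∧
      ((M.tag b).EndsIn O Z ((M.tag b).init x) ↔
        M.EndsIn (fun i => {x | b :: x ∈ O i}) (fun c => Z (M.tagCfg b c)) (M.init x)) := by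
  have h1 : (M.tag b).Leads O 1 ((M.tag b).init x) (M.tagCfg b (M.init x)) :=
    M.tag_pending b O M.start _
  have h2 := simulate_choice (M' := M.tag b) (O' := O) (Z := Z) (M.tagCfg b) 2 0
    (fun c => Z (M.tagCfg b c)) (fun c hc d => M.tag_step b O c hc d) hn
    fun cf ⟨a, ha⟩ _ => by
      have h : (M.tag b).Halted (M.tagCfg b cf) := ⟨a, by simp only [tag, tagCfg, ha]⟩
      exact ⟨h, endsIn_of_halted _ h⟩
  exact ⟨h1.haltsIn h2.1, h1.endsIn_iff.trans h2.2⟩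

theorem tag_halt_iff (c : M.Cfg) (v : Bool) :
    (M.tag b).prog (M.tagCfg b c).state = .halt v ↔ M.prog c.state = .halt v := by
  cases hp : M.prog c.state <;> simp [tag, tagCfg, hp]

theorem tag_yields [Nonempty β] {O : Unit → Set Word} {v : Bool} {n : ℕ} {x : Word}
    (hn : M.HaltsIn (fun i => {x | b :: x ∈ O i}) n (M.init x)) :
    (M.tag b).Yields O v ((M.tag b).init x) ↔
      M.Yields (fun i => {x | b :: x ∈ O i}) v (M.init x) := by
  rw [Yields, (M.tag_spec b hn).2]
  exact iff_of_eq (congrArg (fun Z => M.EndsIn _ Z (M.init x))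
    (funext fun c => propext (M.tag_halt_iff b c v)))

theorem tag_polyTime [Nonempty β] (hM : M.PolyTime) : (M.tag b).PolyTime := by
  rw [polyTime_iff] at hM ⊢
  obtain ⟨p, hp⟩ := hM
  refine ⟨2 * p + 1, fun O x => ?_⟩
  convert (M.tag_spec b (Z := fun _ => True) (hp (fun i => {x | b :: x ∈ O i}) x)).1 using 1
  simp

theorem tag_lang [Nonempty β] (hM : M.PolyTime) (O : Unit → Set Word) :
    (M.tag b).lang O = M.lang fun i => {x | b :: x ∈ O i} := by
  obtain ⟨p, hp⟩ := M.polyTime_iff.1 hM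
  ext x
  rw [mem_lang_iff, mem_lang_iff, tag_yields _ _ (hp _ _)]

end Tag

/-! ### Choosing a machine by the first bit of the input -/

section Branch

/-- Read and erase the first bit of the input; then start `M₁` or `M₂`. -/
noncomputable abbrev branch (M₁ M₂ : Machine ι β) : Machine ι β where
  Q := Option (Option (M₁.Q ⊕ M₂.Q))
  K := M₁.K × M₂.K
  finQ := by have := M₁.finQ; have := M₂.finQ; infer_instance
  finK := by have := M₁.finK; have := M₂.finK; infer_instance
  start := none
  inp := (M₁.inp, M₂.inp)
  prog
    | none => .step fun h _ =>
        (match h (M₁.inp, M₂.inp) with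
          | none => some none
          | some false => some (some (.inl M₁.start))
          | some true => some (some (.inr M₂.start)),
        fun _ => (none, some .right), fun _ => none)
    | some none => .halt false
    | some (some (.inl q)) =>
        (M₁.prog q).map (fun q => some (some (.inl q))) fun k => (k, M₂.inp)
    | some (some (.inr q)) =>
        (M₂.prog q).map (fun q => some (some (.inr q))) fun k => (M₁.inp, k)

variable (M₁ M₂ : Machine ι β)

/-- Tapes are indexed by pairs so that the single input tape `(M₁.inp, M₂.inp)` lies in the range of
both embeddings, and the input need not be copied. -/
theorem branch_inl_init (O : ι → Set Word) (x : Word) :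
    (branch M₁ M₂).Leads O 1 ((branch M₁ M₂).init (false :: x))
      ((M₁.init x).map (fun q => some (some (.inl q))) (fun k => (k, M₂.inp))
        fun _ => wordTape [] []) := by
  classical
  intro b
  rw [(branch M₁ M₂).next_step rfl]
  simp only [init_eq, Leads, Cfg.map]
  have h0 := tapeAct_blank
  congr 1
  · funext ⟨k₁, k₂⟩
    by_cases h2 : k₂ = M₂.inp
    · subst h2
      have hinj : Injective fun k : M₁.K => (k, M₂.inp) := fun a b h => (Prod.mk.inj h).1
      rw [hinj.extend_apply _ _ k₁]
      by_cases h1 : k₁ = M₁.inp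
      · subst h1
        simp only [if_true]
        exact wordTape_erase x false
      · simp only [Prod.mk.injEq, h1, and_true, if_false, h0]
    · rw [extend_apply' _ _ _ (by rintro ⟨a, ha⟩; exact h2 (Prod.mk.inj ha).2.symm)]
      simp only [Prod.mk.injEq, h2, and_false, if_false, h0]

theorem branch_inr_init (O : ι → Set Word) (x : Word) :
    (branch M₁ M₂).Leads O 1 ((branch M₁ M₂).init (true :: x))
      ((M₂.init x).map (fun q => some (some (.inr q))) (fun k => (M₁.inp, k))
        fun _ => wordTape [] []) := by
  classical
  intro b
  rw [(branch M₁ M₂).next_step rfl]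
  simp only [init_eq, Leads, Cfg.map]
  have h0 := tapeAct_blank
  congr 1
  · funext ⟨k₁, k₂⟩
    by_cases h1 : k₁ = M₁.inp
    · subst h1
      have hinj : Injective fun k : M₂.K => (M₁.inp, k) := fun a b h => (Prod.mk.inj h).2
      rw [hinj.extend_apply _ _ k₂]
      by_cases h2 : k₂ = M₂.inp
      · subst h2
        simp only [if_true]
        exact wordTape_erase x true
      · simp only [Prod.mk.injEq, h2, true_and, if_false, h0]
    · rw [extend_apply' _ _ _ (by rintro ⟨a, ha⟩; exact h1 (Prod.mk.inj ha).1.symm)]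
      simp only [Prod.mk.injEq, h1, false_and, if_false, h0]

theorem branch_nil_init (O : ι → Set Word) (b : β) :
    ((branch M₁ M₂).next O b ((branch M₁ M₂).init [])).state = some none := by
  rw [(branch M₁ M₂).next_step rfl]
  simp only [branch, init_eq, if_true, wordTape_head_nil]

/-- The disjoint union of two languages. -/
def join (A B : Set Word) : Set Word :=
  {y | ∃ x, (y = false :: x ∧ x ∈ A) ∨ (y = true :: x ∧ x ∈ B)}

theorem false_cons_mem_join {A B : Set Word} {x : Word} : false :: x ∈ join A B ↔ x ∈ A := by
  simp [join]

theorem true_cons_mem_join {A B : Set Word} {x : Word} : true :: x ∈ join A B ↔ x ∈ B := by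
  simp [join]

theorem nil_notMem_join {A B : Set Word} : [] ∉ join A B := by
  simp [join]

theorem branch_spec [Nonempty β] {p₁ p₂ : Polynomial ℕ} {O : ι → Set Word}
    (h₁ : ∀ x, M₁.HaltsIn O (p₁.eval x.length) (M₁.init x))
    (h₂ : ∀ x, M₂.HaltsIn O (p₂.eval x.length) (M₂.init x)) (x : Word) :
    (branch M₁ M₂).HaltsIn O ((p₁ + p₂ + 1).eval x.length) ((branch M₁ M₂).init x) ∧
      (x ∈ (branch M₁ M₂).lang O ↔ x ∈ join (M₁.lang O) (M₂.lang O)) := by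
  have hmono : ∀ (p : Polynomial ℕ) (n : ℕ), p.eval n ≤ p.eval (n + 1) := fun p n =>
    eval_monotone p (Nat.le_succ n)
  rw [mem_lang_iff]
  match x with
  | [] =>
    have hh : ∀ b, (branch M₁ M₂).prog
        ((branch M₁ M₂).next O b ((branch M₁ M₂).init [])).state = .halt false := fun b => by
      rw [branch_nil_init]
    constructor
    · refine HaltsIn.mono (n := 1) (Or.inr fun b => ⟨false, hh b⟩) (by simp)
    · rw [Yields, endsIn_iff_next]
      simp only [nil_notMem_join, iff_false, not_exists]
      intro b
      rw [← Yields, yields_of_halt _ (hh b)]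
      simp
  | false :: x =>
    rw [false_cons_mem_join, mem_lang_iff]
    have h := yields_map (M' := branch M₁ M₂) (v := true) (fun q => some (some (.inl q)))
      (fun k => (k, M₂.inp)) (fun a b h => (Prod.mk.inj h).1) (fun _ => wordTape [] [])
      (fun _ => rfl) (h₁ x)
    have hl := branch_inl_init M₁ M₂ O x
    refine ⟨(hl.haltsIn h.1).mono ?_, hl.endsIn_iff.trans h.2⟩
    have := hmono p₁ x.length
    simp only [List.length_cons, Polynomial.eval_add, Polynomial.eval_one]
    omega
  | true :: x =>
    rw [true_cons_mem_join, mem_lang_iff]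
    have h := yields_map (M' := branch M₁ M₂) (v := true) (fun q => some (some (.inr q)))
      (fun k => (M₁.inp, k)) (fun a b h => (Prod.mk.inj h).2) (fun _ => wordTape [] [])
      (fun _ => rfl) (h₂ x)
    have hl := branch_inr_init M₁ M₂ O x
    refine ⟨(hl.haltsIn h.1).mono ?_, hl.endsIn_iff.trans h.2⟩
    have := hmono p₂ x.length
    simp only [List.length_cons, Polynomial.eval_add, Polynomial.eval_one]
    omega

end Branch

end Machine

end QueryOrder

namespace QueryOrder

open Function Turing

namespace Machine

variable {β : Type}

/-! ### Combining the verdicts of two machines -/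

section Par

/-- Run `M₁`, then `M₂` on another group of tapes, and combine the verdicts. -/
noncomputable abbrev par (op : Bool → Bool → Bool) (M₁ M₂ : Machine Unit β) : Machine Unit β where
  Q := M₁.Q ⊕ (Bool × M₂.Q)
  K := M₁.K ⊕ M₂.K
  finQ := by have := M₁.finQ; have := M₂.finQ; infer_instance
  finK := by have := M₁.finK; have := M₂.finK; infer_instance
  start := .inl M₁.start
  inp := .inl M₁.inp
  prog
    | .inl q =>
      match M₁.prog q with
      | .halt a => .query Finset.univ fun _ => .inr (a, M₂.start)
      | .query S nxt => (Instr.query S nxt).map .inl .inl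
      | .step δ => (Instr.step δ).map .inl .inl
    | .inr (a, q) =>
      match M₂.prog q with
      | .halt a' => .halt (op a a')
      | .query S nxt => (Instr.query S nxt).map (fun q => .inr (a, q)) .inr
      | .step δ => (Instr.step δ).map (fun q => .inr (a, q)) .inr

/-- Run `M₁` and `M₂` on the same input and combine the verdicts. -/
noncomputable abbrev both (op : Bool → Bool → Bool) (M₁ M₂ : Machine Unit β) : Machine Unit β :=
  (par op M₁ M₂).prep {.inr M₂.inp} ∅

variable (op : Bool → Bool → Bool) (M₁ M₂ : Machine Unit β)

/-- The tapes of `M₁` may hold anything when `M₂` starts, hence the arbitrary `τ`. -/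
theorem par_snd [Nonempty β] {O : Unit → Set Word} {x : Word} {n : ℕ} {v : Bool}
    (hn : M₂.HaltsIn O n (M₂.init x)) (a : Bool) (τ : M₁.K ⊕ M₂.K → Tape (Option Bool)) :
    (par op M₁ M₂).HaltsIn O n ((M₂.init x).map (fun q => .inr (a, q)) .inr τ) ∧
      ((par op M₁ M₂).Yields O v ((M₂.init x).map (fun q => .inr (a, q)) .inr τ) ↔
        ∃ a', M₂.Yields O a' (M₂.init x) ∧ v = op a a') := by
  have h := simulate_map (M' := par op M₁ M₂) (T := 0)
    (Z := fun c => (par op M₁ M₂).prog c.state = .halt v) (fun q => .inr (a, q)) .inr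
    Sum.inr_injective τ (fun c => ∃ a', M₂.prog c.state = .halt a' ∧ v = op a a') ?_ hn ?_
  · rw [endsIn_exists_halt] at h
    exact h
  · intro q hq
    cases hp : M₂.prog q with
    | halt a' => exact absurd hp (hq a')
    | query S nxt => simp only [hp]
    | step δ => simp only [hp]
  · rintro cf ⟨a', ha'⟩ -
    have h : (par op M₁ M₂).prog (cf.map (M' := par op M₁ M₂) (fun q => .inr (a, q)) .inr τ).state =
        .halt (op a a') := by simp only [Cfg.map, ha']
    refine ⟨⟨_, h⟩, ?_⟩
    rw [endsIn_of_halted _ ⟨_, h⟩, h]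
    simp only [ha', Instr.halt.injEq, exists_eq_left']
    exact eq_comm

theorem par_multiInit (x : Word) :
    (par op M₁ M₂).multiInit {.inr M₂.inp} ∅ x =
      (M₁.init x).map (M' := par op M₁ M₂) .inl .inl (Sum.elim (fun _ => wordTape [] []) (M₂.init x).tape) := by
  classical
  simp only [multiInit, Cfg.map, init_eq]
  congr 1
  · funext k
    cases k with
    | inl k => rw [Sum.inl_injective.extend_apply]; simp
    | inr k => rw [extend_apply' _ _ _ (by simp)]; simp
  · funext i
    simp

theorem par_spec [Nonempty β] {O : Unit → Set Word} {x : Word} {n₁ n₂ : ℕ} {v : Bool}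
    (h₁ : M₁.HaltsIn O n₁ (M₁.init x)) (h₂ : M₂.HaltsIn O n₂ (M₂.init x)) :
    (par op M₁ M₂).HaltsIn O (n₁ + (n₂ + 1)) ((par op M₁ M₂).multiInit {.inr M₂.inp} ∅ x) ∧
      ((par op M₁ M₂).Yields O v ((par op M₁ M₂).multiInit {.inr M₂.inp} ∅ x) ↔
        ∃ a, M₁.Yields O a (M₁.init x) ∧ ∃ a', M₂.Yields O a' (M₂.init x) ∧ v = op a a') := by
  classical
  rw [par_multiInit]
  have h := simulate_map (M' := par op M₁ M₂) (T := n₂ + 1)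
    (Z := fun c => (par op M₁ M₂).prog c.state = .halt v) .inl .inl Sum.inl_injective
    (Sum.elim (fun _ => wordTape [] []) (M₂.init x).tape)
    (fun c => ∃ a, M₁.prog c.state = .halt a ∧ ∃ a', M₂.Yields O a' (M₂.init x) ∧ v = op a a')
    ?_ h₁ ?_
  · rw [endsIn_exists_halt M₁ (P := fun a => ∃ a', M₂.Yields O a' (M₂.init x) ∧ v = op a a')] at h
    exact h
  · intro q hq
    cases hp : M₁.prog q with
    | halt a' => exact absurd hp (hq a')
    | query S nxt => simp only [hp]
    | step δ => simp only [hp]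
  · rintro cf ⟨a, ha⟩ -
    -- The answer to this query is ignored; its purpose is to erase the query tape, so that `M₂`
    -- starts from its true initial configuration.
    have hl : (par op M₁ M₂).Leads O 1
        (cf.map .inl .inl (Sum.elim (fun _ => wordTape [] []) (M₂.init x).tape))
        ((M₂.init x).map (fun q => .inr (a, q)) .inr
          (extend .inl cf.tape (Sum.elim (fun _ => wordTape [] []) (M₂.init x).tape))) := by
      intro b
      have hq : (par op M₁ M₂).prog (cf.map (M' := par op M₁ M₂) .inl .inl
          (Sum.elim (fun _ => wordTape [] []) (M₂.init x).tape)).state =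
          .query Finset.univ fun _ => .inr (a, M₂.start) := by simp only [Cfg.map, ha]
      rw [(par op M₁ M₂).next_query hq]
      simp only [Leads, Cfg.map, Finset.mem_univ, if_true]
      congr 1
      funext k
      cases k with
      | inl k => rw [extend_apply' (f := Sum.inr) _ _ _ (by simp)]
      | inr k =>
        rw [Sum.inr_injective.extend_apply, extend_apply' (f := Sum.inl) _ _ _ (by simp)]
        rfl
    have h2 := par_snd op M₁ M₂ (v := v) h₂ a
      (extend .inl cf.tape (Sum.elim (fun _ => wordTape [] []) (M₂.init x).tape))
    refine ⟨hl.haltsIn h2.1, (hl.endsIn_iff.trans h2.2).trans ?_⟩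
    simp only [ha, Instr.halt.injEq, exists_eq_left']

theorem both_spec [Nonempty β] {O : Unit → Set Word} {x : Word} {n₁ n₂ : ℕ} {v : Bool}
    (h₁ : M₁.HaltsIn O n₁ (M₁.init x)) (h₂ : M₂.HaltsIn O n₂ (M₂.init x)) :
    (both op M₁ M₂).HaltsIn O (n₁ + (n₂ + 1) + (2 * x.length + 3)) ((both op M₁ M₂).init x) ∧
      ((both op M₁ M₂).Yields O v ((both op M₁ M₂).init x) ↔
        ∃ a, M₁.Yields O a (M₁.init x) ∧ ∃ a', M₂.Yields O a' (M₂.init x) ∧ v = op a a') := by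
  have h := par_spec op M₁ M₂ (v := v) h₁ h₂
  have h' := (par op M₁ M₂).prep_spec {.inr M₂.inp} ∅ (v := v) h.1
  exact ⟨h'.1, h'.2.trans h.2⟩

theorem both_polyTime [Nonempty β] (h₁ : M₁.PolyTime) (h₂ : M₂.PolyTime) :
    (both op M₁ M₂).PolyTime := by
  rw [polyTime_iff] at h₁ h₂ ⊢
  obtain ⟨p₁, h₁⟩ := h₁
  obtain ⟨p₂, h₂⟩ := h₂
  refine ⟨p₁ + (p₂ + 1) + (2 * .X + 3), fun O x => ?_⟩
  have := (both_spec op M₁ M₂ (v := true) (h₁ O x) (h₂ O x)).1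
  simpa using this

theorem both_yields [Nonempty β] (h₁ : M₁.PolyTime) (h₂ : M₂.PolyTime) {O : Unit → Set Word}
    {x : Word} {v : Bool} : (both op M₁ M₂).Yields O v ((both op M₁ M₂).init x) ↔
      ∃ a, M₁.Yields O a (M₁.init x) ∧ ∃ a', M₂.Yields O a' (M₂.init x) ∧ v = op a a' := by
  rw [polyTime_iff] at h₁ h₂
  obtain ⟨p₁, h₁⟩ := h₁
  obtain ⟨p₂, h₂⟩ := h₂
  exact (both_spec op M₁ M₂ (h₁ O x) (h₂ O x)).2

end Par

/-! ### Running a machine on a computed word -/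

section Comp

/-- The machine `N` with additional tapes. -/
noncomputable abbrev widen (N : Machine Unit β) (G : Machine Unit β) (out : G.K) :
    Machine Unit β where
  Q := N.Q
  K := G.K ⊕ N.K
  finQ := N.finQ
  finK := by have := G.finK; have := N.finK; infer_instance
  start := N.start
  inp := .inl out
  prog q := (N.prog q).map id .inr

/-- Run `G`; if it accepts, run `N` on the word that `G` has left on its tape `out`. -/
noncomputable abbrev comp (G : Machine Unit β) (out : G.K) (N : Machine Unit β) :
    Machine Unit β where
  Q := G.Q ⊕ ((widen N G out).back (.inl out) {.inr N.inp}).Q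
  K := G.K ⊕ N.K
  finQ := by
    have := G.finQ
    have := ((widen N G out).back (.inl out) {.inr N.inp}).finQ
    infer_instance
  finK := by have := G.finK; have := N.finK; infer_instance
  start := .inl G.start
  inp := .inl G.inp
  prog
    | .inl q =>
      match G.prog q with
      | .halt true =>
          .query Finset.univ fun _ => .inr ((widen N G out).back (.inl out) {.inr N.inp}).start
      | .halt false => .halt false
      | .query S nxt => (Instr.query S nxt).map .inl .inl
      | .step δ => (Instr.step δ).map .inl .inl
    | .inr q => (((widen N G out).back (.inl out) {.inr N.inp}).prog q).map .inr id

variable (G : Machine Unit β) (out : G.K) (N : Machine Unit β)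

theorem comp_snd [Nonempty β] {O : Unit → Set Word} {y : Word} {n : ℕ} {v : Bool}
    (hn : N.HaltsIn O n (N.init y)) (τ : G.K ⊕ N.K → Tape (Option Bool))
    (hout : τ (.inl out) = wordTape y.reverse []) (hτ : ∀ k, τ (.inr k) = wordTape [] []) :
    (comp G out N).HaltsIn O (n + (y.length + 2)) ⟨.inr (.inl false), τ, fun _ => []⟩ ∧
      ((comp G out N).Yields O v ⟨.inr (.inl false), τ, fun _ => []⟩ ↔
        N.Yields O v (N.init y)) := by
  classical
  have h1 := yields_map (M := N) (M' := widen N G out) (v := v) id .inr Sum.inr_injective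
    (fun k => if k = .inl out ∨ k = .inr N.inp then wordTape [] y else τ k) (fun _ => rfl) hn
  have e : Cfg.map (M := N) (M' := widen N G out) id .inr
      (fun k => if k = .inl out ∨ k = .inr N.inp then wordTape [] y else τ k) (N.init y) =
      ⟨N.start, fun k => if k = .inl out ∨ k ∈ ({.inr N.inp} : Set (G.K ⊕ N.K)) then wordTape [] y
        else τ k, fun _ => []⟩ := by
    simp only [Cfg.map, init_eq]
    congr 1
    funext k
    cases k with
    | inl k => rw [extend_apply' _ _ _ (by simp)]; simp
    | inr k =>
      rw [Sum.inr_injective.extend_apply]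
      simp only [Set.mem_singleton_iff, reduceCtorEq, false_or, Sum.inr.injEq, hτ]
  rw [e] at h1
  have h2 := (widen N G out).back_spec (.inl out) {.inr N.inp} (v := v) hout
    (fun k hk _ => by rw [Set.mem_singleton_iff.1 hk, hτ])
    (κ := fun _ => []) (O := O) (n := n) (by convert h1.1)
  have h3 := yields_map (M' := comp G out N) (v := v) .inr id injective_id τ (fun _ => rfl) h2.1
  have e3 : Cfg.map (M := (widen N G out).back (.inl out) {.inr N.inp}) (M' := comp G out N)
      .inr id τ ⟨.inl false, τ, fun _ => []⟩ = ⟨.inr (.inl false), τ, fun _ => []⟩ := by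
    simp only [Cfg.map, extend_id]
  rw [e3] at h3
  exact ⟨h3.1, h3.2.trans (h2.2.trans (by convert h1.2))⟩

/-- The word `y` must be the same for all accepting computations of `G`; nothing is required of the
rejecting ones, since `N` is not started after them. -/
theorem comp_spec [Nonempty β] {O : Unit → Set Word} {x y : Word} {n m : ℕ}
    (hG : G.HaltsIn O n (G.init x)) (hN : N.HaltsIn O m (N.init y))
    (hy : ∀ cf, G.EndsIn O (· = cf) (G.init x) → G.prog cf.state = .halt true →
      cf.tape out = wordTape y.reverse []) :
    (comp G out N).HaltsIn O (n + (m + (y.length + 2) + 1)) ((comp G out N).init x) ∧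
      (x ∈ (comp G out N).lang O ↔ x ∈ G.lang O ∧ y ∈ N.lang O) := by
  classical
  rw [mem_lang_iff, mem_lang_iff, mem_lang_iff]
  have e : (comp G out N).init x = (G.init x).map (M' := comp G out N) .inl .inl fun _ => wordTape [] [] := by
    simp only [Cfg.map, init_eq]
    congr 1
    funext k
    cases k with
    | inl k => rw [Sum.inl_injective.extend_apply]; simp
    | inr k => rw [extend_apply' _ _ _ (by simp)]; simp
  rw [e]
  have h := simulate_map (M' := comp G out N) (T := m + (y.length + 2) + 1)
    (Z := fun c => (comp G out N).prog c.state = .halt true) .inl .inl Sum.inl_injective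
    (fun _ => wordTape [] [])
    (fun c => ∃ a, G.prog c.state = .halt a ∧ a = true ∧ N.Yields O true (N.init y))
    ?_ hG ?_
  · rw [endsIn_exists_halt G (P := fun a => a = true ∧ N.Yields O true (N.init y))] at h
    refine ⟨h.1, h.2.trans ?_⟩
    simp
  · intro q hq
    cases hp : G.prog q with
    | halt a' => exact absurd hp (hq a')
    | query S nxt => simp only [hp]
    | step δ => simp only [hp]
  · rintro cf ⟨a, ha⟩ hcf
    cases a with
    | false =>
      have h : (comp G out N).prog
          (cf.map (M' := comp G out N) .inl .inl fun _ => wordTape [] []).state =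
          .halt false := by simp only [Cfg.map, ha]
      refine ⟨Halted.haltsIn ⟨_, h⟩ _, ?_⟩
      rw [endsIn_of_halted _ ⟨_, h⟩, h]
      simp [ha]
    | true =>
      -- As in `par`, a query with ignored answer empties the query tape.
      have hl : (comp G out N).Leads O 1 (cf.map .inl .inl fun _ => wordTape [] [])
          ⟨.inr (.inl false), extend .inl cf.tape fun _ => wordTape [] [], fun _ => []⟩ := by
        intro b
        have hq : (comp G out N).prog
            (cf.map (M' := comp G out N) .inl .inl fun _ => wordTape [] []).state =
            .query Finset.univ fun _ => .inr (.inl false) := by simp only [Cfg.map, ha]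
        rw [(comp G out N).next_query hq]
        simp only [Leads, Cfg.map, Finset.mem_univ, if_true]
      have h2 := comp_snd G out N (v := true) hN (extend .inl cf.tape fun _ => wordTape [] [])
        (by rw [Sum.inl_injective.extend_apply, hy cf hcf ha])
        (fun k => by rw [extend_apply' _ _ _ (by simp)])
      refine ⟨hl.haltsIn h2.1, (hl.endsIn_iff.trans h2.2).trans ?_⟩
      simp [ha]

end Comp

end Machine

end QueryOrder

/-! ### Inclusions and joins in the polynomial hierarchy; analysis of a two-query machine -/

namespace QueryOrder

open Function Turing

namespace Machine

variable {β : Type}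

/-- Ask the oracle about the word on the query tape. -/
abbrev ask : Machine Unit β where
  Q := Option Bool
  K := Unit
  finQ := inferInstance
  finK := inferInstance
  start := none
  inp := ()
  prog
    | none => .query Finset.univ fun a => some (a ())
    | some a => .halt a

theorem ask_spec [Nonempty β] (O : Unit → Set Word) (x : Word) :
    (ask : Machine Unit β).HaltsIn O 1 (ask.multiInit ∅ Set.univ x) ∧
      ((ask : Machine Unit β).Yields O true (ask.multiInit ∅ Set.univ x) ↔ x ∈ O ()) := by
  classical
  have h : ∀ b, (ask : Machine Unit β).prog
      ((ask : Machine Unit β).next O b (ask.multiInit ∅ Set.univ x)).state =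
      .halt (decide (x ∈ O ())) := fun b => by
    rw [next_query _ (S := Finset.univ) (nxt := fun a => some (a ())) rfl]
    simp [multiInit]
  constructor
  · exact Or.inr fun b => ⟨_, h b⟩
  · rw [Yields, endsIn_iff_next]
    simp only [← Yields.eq_1, yields_of_halt _ (h _), exists_const]
    exact eq_comm.trans decide_eq_true_iff

end Machine

theorem self_mem_classNP (A : Set Word) : A ∈ classNP A := by
  have h := fun (O : Unit → Set Word) x =>
    (Machine.ask (β := Bool)).prep_spec ∅ Set.univ (v := true) (Machine.ask_spec O x).1
  refine ⟨Machine.ask.prep ∅ Set.univ, ?_, ?_⟩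
  · rw [Machine.polyTime_iff]
    refine ⟨1 + (2 * .X + 3), fun O x => ?_⟩
    simpa using (h O x).1
  · ext x
    rw [Machine.mem_lang_iff, (h _ x).2, (Machine.ask_spec _ x).2]

theorem sigma_mono : Monotone sigma :=
  monotone_nat_of_le_succ fun _ A hA => ⟨A, hA, self_mem_classNP A⟩

/-- Above level zero, the underlying oracles are joined by induction and each machine prefixes its
queries with the bit of its own oracle; `branch` then selects the machine by the first input bit. -/
theorem join_mem_sigma (m : ℕ) {A B : Set Word} (hA : A ∈ sigma m) (hB : B ∈ sigma m) :
    Machine.join A B ∈ sigma m := by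
  induction m generalizing A B with
  | zero =>
    obtain ⟨M₁, h₁, rfl⟩ := hA
    obtain ⟨M₂, h₂, rfl⟩ := hB
    rw [Machine.polyTime_iff] at h₁ h₂
    obtain ⟨p₁, h₁⟩ := h₁
    obtain ⟨p₂, h₂⟩ := h₂
    have h := fun O => M₁.branch_spec M₂ (h₁ O) (h₂ O)
    refine ⟨M₁.branch M₂, ?_, ?_⟩
    · rw [Machine.polyTime_iff]
      exact ⟨_, fun O x => (h O x).1⟩
    · ext x
      exact (h _ x).2.symm
  | succ m ih =>
    obtain ⟨A', hA', M₁, h₁, rfl⟩ := hA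
    obtain ⟨B', hB', M₂, h₂, rfl⟩ := hB
    refine ⟨Machine.join A' B', ih hA' hB', (M₁.tag false).branch (M₂.tag true), ?_⟩
    obtain ⟨p₁, h₁'⟩ := (Machine.polyTime_iff _).1 (M₁.tag_polyTime false h₁)
    obtain ⟨p₂, h₂'⟩ := (Machine.polyTime_iff _).1 (M₂.tag_polyTime true h₂)
    have h := fun O => (M₁.tag false).branch_spec (M₂.tag true) (h₁' O) (h₂' O)
    constructor
    · rw [Machine.polyTime_iff]
      exact ⟨_, fun O x => (h O x).1⟩
    · ext x
      rw [(h _ x).2, M₁.tag_lang false h₁, M₂.tag_lang true h₂]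
      simp only [Machine.false_cons_mem_join, Machine.true_cons_mem_join, Set.ofPred_mem_eq]

namespace Machine

/-- The oracle `i` is asked in the configuration `c`. -/
def Asks {ι β : Type} (M : Machine ι β) (c : M.Cfg) (i : ι) : Prop :=
  ∃ S nxt, M.prog c.state = .query S nxt ∧ i ∈ S

variable (M : Machine (Fin 2) Unit)

/-! ### Fixing the answers of the second oracle -/

section Const

/-- Simulate `M`, answering all queries to the second oracle by `i`, and reject when the first
oracle is asked for the second time. -/
abbrev const (i : Bool) : Machine Unit Bool where
  Q := M.Q × Bool
  K := M.K
  finQ := by have := M.finQ; infer_instance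
  finK := M.finK
  start := (M.start, false)
  inp := M.inp
  prog
    | (q, f) =>
      match M.prog q with
      | .halt a => .halt a
      | .query S nxt =>
        if 0 ∈ S then
          if f then .halt false
          else .query Finset.univ fun a => (nxt ![a (), decide (1 ∈ S) && i], true)
        else .step fun h _ =>
          ((nxt ![false, decide (1 ∈ S) && i], f), fun k => (h k, none), fun _ => none)
      | .step δ => .step fun h _ => (((δ h ()).1, f), (δ h ()).2.1, fun _ => (δ h ()).2.2 0)

variable (i : Bool)

/-- The configuration of `M.const i` that corresponds to a configuration of `M`. -/
def constCfg (c : M.Cfg) (f : Bool) : (M.const i).Cfg := ⟨(c.state, f), c.tape, fun _ => c.qtape 0⟩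

theorem const_halt_true_iff (c : M.Cfg) (f : Bool) :
    (M.const i).prog (M.constCfg i c f).state = .halt true ↔ M.prog c.state = .halt true := by
  cases hp : M.prog c.state with
  | halt a => simp [constCfg, hp]
  | query S nxt =>
    by_cases h0 : 0 ∈ S <;> cases f <;> simp [constCfg, hp, h0]
  | step δ => simp [constCfg, hp]

open scoped Classical in
-- The hypothesis `hf` excludes the forced rejection, and `hi` says that the fixed answer is the
-- right one whenever it is used.
theorem const_next {O : Fin 2 → Set Word} {c : M.Cfg} {f : Bool} (b : Bool)
    (hf : f = true → ¬ M.Asks c 0) (hi : M.Asks c 1 → (c.qtape 1 ∈ O 1 ↔ i = true)) :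
    (M.const i).next (fun _ => O 0) b (M.constCfg i c f) =
      M.constCfg i (M.next O () c) (f || decide (M.Asks c 0)) := by
  cases hp : M.prog c.state with
  | halt a =>
    have h : (M.const i).prog (M.constCfg i c f).state = .halt a := by simp only [constCfg, hp]
    rw [next_halt _ h, next_halt _ hp]
    simp [Asks, hp]
  | query S nxt =>
    have ha : ∀ j, M.Asks c j ↔ j ∈ S := fun j => by
      simp only [Asks, hp, Instr.query.injEq]
      exact ⟨fun ⟨_, _, ⟨h, _⟩, hj⟩ => h ▸ hj, fun hj => ⟨_, _, ⟨rfl, rfl⟩, hj⟩⟩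
    rw [ha] at hf hi
    -- An oracle that is not asked contributes `false`, so the fixed answer `i` has to be masked.
    have h1 : (decide (1 ∈ S) && i) = decide (1 ∈ S ∧ c.qtape 1 ∈ O 1) := by
      by_cases h : 1 ∈ S
      · simp [h, hi h]
      · simp [h]
    rw [next_query _ hp]
    by_cases h0 : 0 ∈ S
    · have hf' : f = false := by
        cases f with
        | false => rfl
        | true => exact absurd h0 (hf rfl)
      have h : (M.const i).prog (M.constCfg i c f).state =
          .query Finset.univ fun a => (nxt ![a (), decide (1 ∈ S) && i], true) := by
        simp only [constCfg, hp, hf', h0, if_true]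
        rfl
      rw [next_query _ h, h1]
      simp only [constCfg, Finset.mem_univ, true_and, if_true, h0, ha, decide_true, Bool.or_true,
        Cfg.mk.injEq, Prod.mk.injEq, and_true]
      congr 1
      funext j
      fin_cases j <;> simp [h0]
    · have h : (M.const i).prog (M.constCfg i c f).state = .step fun h _ =>
          ((nxt ![false, decide (1 ∈ S) && i], f), fun k => (h k, none), fun _ => none) := by
        simp only [constCfg, hp, h0, if_false]
      rw [next_step _ h, h1]
      simp only [constCfg, h0, if_false, ha, decide_false, Bool.or_false, tapeAct_idle,
        Option.toList_none, List.append_nil, Cfg.mk.injEq, Prod.mk.injEq, and_true]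
      congr 1
      funext j
      fin_cases j <;> simp [h0]
  | step δ =>
    have h : (M.const i).prog (M.constCfg i c f).state = .step fun h _ =>
        (((δ h ()).1, f), (δ h ()).2.1, fun _ => (δ h ()).2.2 0) := by simp only [constCfg, hp]
    rw [next_step _ h, next_step _ hp]
    have ha : ¬ M.Asks c 0 := by simp [Asks, hp]
    simp only [ha, decide_false, Bool.or_false]
    rfl

/-- A constant answer `i` is what the oracle `∅` or the set of all words would give. The clock of
`M` does not depend on the oracles, so it also bounds this possibly counterfactual run; a forced
rejection only shortens it. -/
theorem const_haltsIn {O : Fin 2 → Set Word} (hO : O 1 = {_x | i = true}) {n : ℕ} {c : M.Cfg}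
    (f : Bool) (hn : M.HaltsIn O n c) :
    (M.const i).HaltsIn (fun _ => O 0) n (M.constCfg i c f) := by
  have hh : ∀ c f, M.Halted c → (M.const i).Halted (M.constCfg i c f) := fun c f ⟨a, ha⟩ =>
    ⟨a, by simp only [constCfg, ha]⟩
  induction n generalizing c f with
  | zero => exact hh c f hn
  | succ n ih =>
    obtain h | h := hn
    · exact (hh c f h).haltsIn _
    · by_cases hf : f = true ∧ M.Asks c 0
      · obtain ⟨rfl, S, nxt, hp, h0⟩ := hf
        exact Halted.haltsIn ⟨false, by simp only [constCfg, hp, h0, if_true]⟩ _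
      · refine Or.inr fun b => ?_
        rw [M.const_next i (O := O) b (fun h1 h2 => hf ⟨h1, h2⟩) fun _ => by rw [hO]; rfl]
        exact ih _ (h ())

theorem const_polyTime (hM : M.PolyTime) : (M.const i).PolyTime := by
  rw [polyTime_iff] at hM ⊢
  obtain ⟨p, hp⟩ := hM
  exact ⟨p, fun O x =>
    M.const_haltsIn i (O := ![O (), {_x | i = true}]) rfl false (hp ![O (), {_x | i = true}] x)⟩

/-- With the true oracles the first one is asked at most once, so the forced rejection never occurs
and `M.const i` follows `M` step by step. -/
theorem const_run {O : Fin 2 → Set Word} (hM : M.AtMostOneEach O) {w : ℕ → Unit} {x : Word}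
    (hi : ∀ t, M.AsksAt O w x t 1 → ((M.run O w x t).qtape 1 ∈ O 1 ↔ i = true))
    (w' : ℕ → Bool) (t : ℕ) :
    ∃ f, (M.const i).run (fun _ => O 0) w' x t = M.constCfg i (M.run O w x t) f ∧
      (f = true → ∃ s < t, M.AsksAt O w x s 0) := by
  classical
  induction t with
  | zero => exact ⟨false, rfl, by simp⟩
  | succ t ih =>
    obtain ⟨f, h, hf⟩ := ih
    refine ⟨f || decide (M.Asks (M.run O w x t) 0), ?_, ?_⟩
    · rw [run, h]
      refine M.const_next i _ (fun h1 h2 => ?_) (hi t)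
      obtain ⟨s, hs, h3⟩ := hf h1
      exact absurd (hM w x 0 s t h3 h2) hs.ne
    · intro h'
      rw [Bool.or_eq_true, decide_eq_true_eq] at h'
      obtain h' | h' := h'
      · obtain ⟨s, hs, h3⟩ := hf h'
        exact ⟨s, hs.trans t.lt_succ_self, h3⟩
      · exact ⟨t, t.lt_succ_self, h'⟩

theorem mem_const_lang {O : Fin 2 → Set Word} (hM : M.AtMostOneEach O) {x : Word}
    (hi : ∀ w t, M.AsksAt O w x t 1 → ((M.run O w x t).qtape 1 ∈ O 1 ↔ i = true)) :
    x ∈ (M.const i).lang (fun _ => O 0) ↔ x ∈ M.lang O := by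
  constructor
  · rintro ⟨w', t, h⟩
    obtain ⟨f, hf, -⟩ := M.const_run i hM (hi fun _ => ()) w' t
    rw [hf, const_halt_true_iff] at h
    exact ⟨_, t, h⟩
  · rintro ⟨w, t, h⟩
    obtain ⟨f, hf, -⟩ := M.const_run i hM (hi w) (fun _ => true) t
    refine ⟨fun _ => true, t, ?_⟩
    rwa [hf, const_halt_true_iff]

theorem const_query {s : M.Q × Bool} {S : Finset Unit} {nxt : (Unit → Bool) → M.Q × Bool}
    (h : (M.const i).prog s = .query S nxt) :
    S = Finset.univ ∧ s.2 = false ∧ ∀ a, (nxt a).2 = true := by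
  obtain ⟨q, f⟩ := s
  cases hp : M.prog q with
  | halt a => simp [hp] at h
  | query S' nxt' =>
    simp only [hp] at h
    split_ifs at h with h0 hf
    obtain ⟨rfl, rfl⟩ := Instr.query.inj h
    exact ⟨rfl, by simpa using hf, fun _ => rfl⟩
  | step δ => simp [hp] at h

theorem const_step {s : M.Q × Bool} {δ : (M.K → Option Bool) → Bool →
    (M.Q × Bool) × (M.K → Option Bool × Option Dir) × (Unit → Option Bool)}
    (h : (M.const i).prog s = .step δ) (g : M.K → Option Bool) (b : Bool) :
    δ g b = δ g true ∧ (δ g b).1.2 = s.2 := by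
  obtain ⟨q, f⟩ := s
  cases hp : M.prog q with
  | halt a => simp [hp] at h
  | query S nxt =>
    simp only [hp] at h
    split_ifs at h
    rw [← Instr.step.inj h]
    exact ⟨rfl, rfl⟩
  | step δ' =>
    simp only [hp] at h
    rw [← Instr.step.inj h]
    exact ⟨rfl, rfl⟩

/-- Used when `parallelize` asks its second oracle only at the end: this sets the flag, and the
verdict must survive. -/
theorem const_halt {s : M.Q × Bool} {a : Bool} (h : (M.const i).prog s = .halt a) :
    (M.const i).prog (s.1, true) = .halt a := by
  obtain ⟨q, f⟩ := s
  cases hp : M.prog q with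
  | halt a' => simpa [hp] using h
  | query S nxt =>
    simp only [hp] at h
    split_ifs at h with h0 hf
    simpa [hp, h0] using h
  | step δ => simp [hp] at h

theorem const_next_eq {O : Unit → Set Word} (b : Bool) (c : (M.const i).Cfg) :
    (M.const i).next O b c = (M.const i).next O true c := by
  cases hp : (M.const i).prog c.state with
  | halt a => rw [next_halt _ hp, next_halt _ hp]
  | query S nxt => rw [next_query _ hp, next_query _ hp]
  | step δ => rw [next_step _ hp, next_step _ hp, (M.const_step i hp _ b).1]

theorem const_yields_unique {O : Unit → Set Word} {n : ℕ} {c : (M.const i).Cfg}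
    (hn : (M.const i).HaltsIn O n c) :
    ∃ a, ∀ v, (M.const i).Yields O v c ↔ v = a := by
  induction n generalizing c with
  | zero =>
    obtain ⟨a, ha⟩ := hn
    exact ⟨a, fun v => yields_of_halt _ ha⟩
  | succ n ih =>
    obtain ⟨a, ha⟩ | h := hn
    · exact ⟨a, fun v => yields_of_halt _ ha⟩
    · obtain ⟨a, ha⟩ := ih (h true)
      refine ⟨a, fun v => ?_⟩
      rw [Yields, endsIn_iff_next]
      simp only [const_next_eq, exists_const]
      exact ha v

end Const

/-! ### Finding the query to the second oracle -/

section Probe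

/-- Simulate `M`, writing its second query tape on an additional work tape, and accept when the
second oracle is asked. -/
abbrev probe : Machine Unit Bool where
  Q := M.Q
  K := Option M.K
  finQ := M.finQ
  finK := by have := M.finK; infer_instance
  start := M.start
  inp := some M.inp
  prog q :=
    match M.prog q with
    | .halt _ => .halt false
    | .query S nxt =>
      if 1 ∈ S then .halt true
      else if 0 ∈ S then .query Finset.univ fun a => nxt ![a (), false]
      else .step fun h _ => (nxt ![false, false], fun k => (h k, none), fun _ => none)
    | .step δ => .step fun h _ =>
        ((δ (h ∘ some) ()).1,
          fun k => k.elim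
            (match (δ (h ∘ some) ()).2.2 1 with
              | none => (h none, none)
              | some b => (some b, some .right))
            (δ (h ∘ some) ()).2.1,
          fun _ => (δ (h ∘ some) ()).2.2 0)

/-- The configuration of `M.probe` that corresponds to a configuration of `M`. -/
def probeCfg (c : M.Cfg) : M.probe.Cfg :=
  ⟨c.state, fun k => k.elim (wordTape (c.qtape 1).reverse []) c.tape, fun _ => c.qtape 0⟩

theorem probe_next {O : Fin 2 → Set Word} {c : M.Cfg} (b : Bool) (hc : ¬ M.Halted c)
    (h1 : ¬ M.Asks c 1) :
    M.probe.next (fun _ => O 0) b (M.probeCfg c) = M.probeCfg (M.next O () c) := by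
  classical
  cases hp : M.prog c.state with
  | halt a => exact absurd ⟨a, hp⟩ hc
  | query S nxt =>
    have h1 : 1 ∉ S := fun h => h1 ⟨_, _, hp, h⟩
    rw [next_query _ hp]
    by_cases h0 : 0 ∈ S
    · have h : M.probe.prog (M.probeCfg c).state =
          .query Finset.univ fun a => nxt ![a (), false] := by
        simp only [probeCfg, hp, h0, h1, if_true, if_false]
      rw [next_query _ h]
      simp only [probeCfg, Finset.mem_univ, true_and, if_true, h0, h1, if_false, Cfg.mk.injEq,
        and_true]
      congr 1
      funext j
      fin_cases j <;> simp [h0, h1]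
    · have h : M.probe.prog (M.probeCfg c).state = .step fun h _ =>
          (nxt ![false, false], fun k => (h k, none), fun _ => none) := by
        simp only [probeCfg, hp, h0, h1, if_false]
      rw [next_step _ h]
      simp only [probeCfg, h0, h1, if_false, tapeAct_idle, Option.toList_none, List.append_nil,
        Cfg.mk.injEq, and_true]
      congr 1
      funext j
      fin_cases j <;> simp [h0, h1]
  | step δ =>
    have h : M.probe.prog (M.probeCfg c).state = .step fun h _ =>
        ((δ (h ∘ some) ()).1,
          fun k => k.elim
            (match (δ (h ∘ some) ()).2.2 1 with
              | none => (h none, none)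
              | some b => (some b, some .right))
            (δ (h ∘ some) ()).2.1,
          fun _ => (δ (h ∘ some) ()).2.2 0) := by simp only [probeCfg, hp]
    rw [next_step _ h, next_step _ hp]
    have e : (fun k => ((M.probeCfg c).tape k).head) ∘ some = fun k => (c.tape k).head := rfl
    simp only [e]
    simp only [probeCfg, Cfg.mk.injEq, true_and, and_true]
    funext k
    cases k with
    | some k => rfl
    | none =>
      simp only [Option.elim_none]
      cases (δ (fun k => (c.tape k).head) ()).2.2 1 with
      | none => simp only [tapeAct_idle, Option.toList_none, List.append_nil]
      | some a =>
        simp only [Option.toList_some, List.reverse_append, List.reverse_singleton,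
          List.singleton_append]
        exact wordTape_append _ a

/-- The first query of `M` to the second oracle, starting from `c`, is asked after `s` steps. -/
def FirstAsk (O : Fin 2 → Set Word) (c : M.Cfg) (s : ℕ) : Prop :=
  M.Asks (M.runFrom O (fun _ => ()) c s) 1 ∧
    ∀ s' < s, ¬ M.Asks (M.runFrom O (fun _ => ()) c s') 1

theorem firstAsk_succ {O : Fin 2 → Set Word} {c : M.Cfg} (h : ¬ M.Asks c 1) (s : ℕ) :
    M.FirstAsk O c (s + 1) ↔ M.FirstAsk O (M.next O () c) s := by
  simp only [FirstAsk, Nat.forall_lt_succ_left, runFrom_succ', runFrom.eq_1, h, not_false_eq_true,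
    true_and]

variable {M} in
theorem Halted.not_asks {c : M.Cfg} (h : M.Halted c) (i : Fin 2) : ¬ M.Asks c i := by
  obtain ⟨a, ha⟩ := h
  simp [Asks, ha]

theorem probe_of_halted {O : Fin 2 → Set Word} {c : M.Cfg} (hc : M.Halted c) (n : ℕ)
    (Z : M.probe.Cfg → Prop) :
    M.probe.HaltsIn (fun _ => O 0) n (M.probeCfg c) ∧
      (M.probe.EndsIn (fun _ => O 0) (fun cf => M.probe.prog cf.state = .halt true ∧ Z cf)
        (M.probeCfg c) ↔
        ∃ s, M.FirstAsk O c s ∧ Z (M.probeCfg (M.runFrom O (fun _ => ()) c s))) := by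
  obtain ⟨a, ha⟩ := id hc
  have h : M.probe.prog (M.probeCfg c).state = .halt false := by simp only [probeCfg, ha]
  refine ⟨Halted.haltsIn ⟨_, h⟩ n, ?_⟩
  rw [endsIn_of_halted _ ⟨_, h⟩, h]
  simp [FirstAsk, hc.runFrom_eq, hc.not_asks]

/-- The machine stops before any answer of the second oracle is needed, so `O 0` suffices. The free
property `Z` serves to read off the query word in the accepting configuration. -/
theorem probe_spec {O : Fin 2 → Set Word} {n : ℕ} {c : M.Cfg} (hn : M.HaltsIn O n c)
    (Z : M.probe.Cfg → Prop) :
    M.probe.HaltsIn (fun _ => O 0) n (M.probeCfg c) ∧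
      (M.probe.EndsIn (fun _ => O 0) (fun cf => M.probe.prog cf.state = .halt true ∧ Z cf)
        (M.probeCfg c) ↔
        ∃ s, M.FirstAsk O c s ∧ Z (M.probeCfg (M.runFrom O (fun _ => ()) c s))) := by
  induction n generalizing c with
  | zero => exact M.probe_of_halted hn 0 Z
  | succ n ih =>
    by_cases hc : M.Halted c
    · exact M.probe_of_halted hc _ Z
    by_cases h1 : M.Asks c 1
    · obtain ⟨S, nxt, hp, hS⟩ := id h1
      have h : M.probe.prog (M.probeCfg c).state = .halt true := by
        simp only [probeCfg, hp, hS, if_true]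
      refine ⟨Halted.haltsIn ⟨_, h⟩ _, ?_⟩
      rw [endsIn_of_halted _ ⟨_, h⟩]
      refine ⟨fun hZ => ⟨0, ⟨h1, by simp⟩, hZ.2⟩, fun ⟨s, hs, hZ⟩ => ⟨h, ?_⟩⟩
      obtain rfl | h0 := Nat.eq_zero_or_pos s
      · exact hZ
      · exact absurd h1 (hs.2 0 h0)
    · have key := ih (hn.resolve_left hc ())
      refine ⟨Or.inr fun b => ?_, ?_⟩
      · rw [M.probe_next b hc h1]
        exact key.1
      · rw [endsIn_iff_next]
        simp only [M.probe_next _ hc h1, exists_const]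
        rw [key.2]
        constructor
        · rintro ⟨s, hs, hZ⟩
          exact ⟨s + 1, (M.firstAsk_succ h1 s).2 hs, by rwa [runFrom_succ']⟩
        · rintro ⟨s, hs, hZ⟩
          cases s with
          | zero => exact absurd hs.1 h1
          | succ s => exact ⟨s, (M.firstAsk_succ h1 s).1 hs, by rwa [runFrom_succ'] at hZ⟩

theorem probe_init (x : Word) : M.probe.init x = M.probeCfg (M.init x) := by
  classical
  simp only [init_eq, probeCfg]
  congr 1
  funext k
  cases k <;> simp

end Probe

theorem length_qtape_le {ι β : Type} (M : Machine ι β) (O : ι → Set Word) (w : ℕ → β) (x : Word)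
    (t : ℕ) (i : ι) : ((M.run O w x t).qtape i).length ≤ t := by
  classical
  induction t with
  | zero => simp [run, init]
  | succ t ih =>
    rw [run]
    cases hp : M.prog (M.run O w x t).state with
    | halt a => rw [next_halt _ hp]; omega
    | query S nxt =>
      rw [next_query _ hp]
      simp only
      split_ifs
      · simp
      · omega
    | step δ =>
      rw [next_step _ hp]
      simp only [List.length_append]
      have : ∀ o : Option Bool, o.toList.length ≤ 1 := fun o => by cases o <;> simp
      exact Nat.add_le_add ih (this _)

end Machine

end QueryOrder

namespace QueryOrder

open Function Turing

namespace Machine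

variable {ι β : Type}

/-! ### Machines with at most one querying step -/

/-- Every query leads to a state in `D`, and no query is made from then on. -/
structure Once (M : Machine ι β) (D : M.Q → Prop) : Prop where
  no_query : ∀ q S nxt, D q → M.prog q ≠ .query S nxt
  step : ∀ q δ h b, D q → M.prog q = .step δ → D (δ h b).1
  query : ∀ q S nxt a, M.prog q = .query S nxt → D (nxt a)

variable {M : Machine ι β} {D : M.Q → Prop}

theorem Once.next (hD : M.Once D) {O : ι → Set Word} {b : β} {c : M.Cfg} (hc : D c.state) :
    D (M.next O b c).state := by
  cases hp : M.prog c.state with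
  | halt a => rwa [next_halt _ hp]
  | query S nxt => exact absurd hp (hD.no_query _ _ _ hc)
  | step δ =>
    rw [next_step _ hp]
    exact hD.step _ _ _ _ hc hp

/-- After a query the state stays in `D`, where no further query can occur. This is a property of
the program, valid for all oracles. -/
theorem Once.eq_of_asksAt (hD : M.Once D) {O : ι → Set Word} {w : ℕ → β} {x : Word} {t t' : ℕ}
    {i i' : ι} (h : M.AsksAt O w x t i) (h' : M.AsksAt O w x t' i') : t = t' := by
  have key : ∀ t t' i i', M.AsksAt O w x t i → M.AsksAt O w x t' i' → ¬ t < t' := by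
    rintro t t' i i' ⟨S, nxt, hp, -⟩ ⟨S', nxt', hp', -⟩ hlt
    have hd : ∀ m, t < m → D (M.run O w x m).state := by
      intro m hm
      induction hm with
      | refl =>
        rw [run, next_query _ hp]
        exact hD.query _ _ _ _ hp
      | step _ ih => exact hD.next ih
    exact hD.no_query _ _ _ (hd t' hlt) hp'
  exact le_antisymm (not_lt.1 (key _ _ _ _ h' h)) (not_lt.1 (key _ _ _ _ h h'))

theorem Once.prep (hD : M.Once D) (S : Set M.K) (U : Set ι) :
    (M.prep S U).Once fun s => ∃ q, s = some (.inr q) ∧ D q where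
  no_query := by
    rintro _ S' nxt ⟨q, rfl, hq⟩ h
    cases hp : M.prog q with
    | halt a => simp [hp, Instr.map] at h
    | query S nxt => exact hD.no_query _ _ _ hq hp
    | step δ => simp [hp, Instr.map] at h
  step := by
    rintro _ δ g b ⟨q, rfl, hq⟩ h
    cases hp : M.prog q with
    | halt a => simp [hp, Instr.map] at h
    | query S nxt => exact absurd hp (hD.no_query _ _ _ hq)
    | step δ' =>
      simp only [hp, Instr.map, Instr.step.injEq] at h
      subst h
      exact ⟨_, rfl, hD.step _ _ _ _ hq hp⟩
  query := by
    rintro s S' nxt a h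
    match s with
    | none => simp at h
    | some (.inl false) => simp [Instr.map] at h
    | some (.inl true) => simp [Instr.map] at h
    | some (.inr q) =>
      cases hp : M.prog q with
      | halt a => simp [hp, Instr.map] at h
      | query S nxt' =>
        simp only [hp, Instr.map, Instr.query.injEq] at h
        obtain ⟨rfl, rfl⟩ := h
        exact ⟨_, rfl, hD.query _ _ _ _ hp⟩
      | step δ' => simp [hp, Instr.map] at h

/-! ### Asking both oracles at the same time -/

section Parallelize

variable (M : Machine (Fin 2) Unit)

/-- The instruction of `M.parallelize` in the state `(q, o)`, from that of `M.const false`. -/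
def parInstr {Q K : Type} (q : Q) (o : Option Bool) :
    Instr (Q × Bool) K Unit Bool → Instr (Q × Option Bool) K (Fin 2) Unit
  | .halt a =>
    match o with
    | none => .query {1} fun a' => (q, some (a' 1))
    | some b => .halt (xor a b)
  | .query _ nxt => .query Finset.univ fun a' => ((nxt fun _ => a' 0).1, some (a' 1))
  | .step δ => .step fun h _ => (((δ h true).1.1, o), (δ h true).2.1,
      fun j => if j = 0 then (δ h true).2.2 () else none)

/-- Simulate `M.const false`; ask the second oracle about the word that is on its query tape
together with the query of `M` to the first oracle (or in the end if there is none), and negate the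
verdict if the answer is yes. -/
abbrev parallelize : Machine (Fin 2) Unit where
  Q := M.Q × Option Bool
  K := M.K
  finQ := by have := M.finQ; infer_instance
  finK := M.finK
  start := (M.start, none)
  inp := M.inp
  prog s := parInstr s.1 s.2 ((M.const false).prog (s.1, s.2.isSome))

theorem parallelize_prog {q : M.Q} {o : Option Bool} {f : Bool} {I}
    (h : (M.const false).prog (q, f) = I) (ho : o.isSome = f) :
    M.parallelize.prog (q, o) = parInstr q o I := by
  rw [← h, ← ho]

/-- The stored answer is present exactly when the query has been made, and then plays the part of
the flag of `M.const false`, which makes no query once its flag is set. -/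
theorem parallelize_once : M.parallelize.Once fun s => s.2.isSome where
  no_query := by
    rintro ⟨q, o⟩ S nxt ho h
    obtain ⟨b, rfl⟩ := Option.isSome_iff_exists.1 ho
    cases hp : (M.const false).prog (q, true) with
    | halt a => cases (M.parallelize_prog hp rfl).symm.trans h
    | query S' nxt' => exact absurd (M.const_query false hp).2.1 (by simp)
    | step δ => cases (M.parallelize_prog hp rfl).symm.trans h
  step := by
    rintro ⟨q, o⟩ δ g b ho h
    cases hp : (M.const false).prog (q, o.isSome) with
    | halt a => cases o <;> cases (M.parallelize_prog hp rfl).symm.trans h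
    | query S' nxt' => cases (M.parallelize_prog hp rfl).symm.trans h
    | step δ' =>
      obtain rfl := Instr.step.inj ((M.parallelize_prog hp rfl).symm.trans h)
      exact ho
  query := by
    rintro ⟨q, o⟩ S nxt a h
    cases hp : (M.const false).prog (q, o.isSome) with
    | halt a' =>
      cases o with
      | none =>
        obtain ⟨rfl, rfl⟩ := Instr.query.inj ((M.parallelize_prog hp rfl).symm.trans h)
        rfl
      | some b => cases (M.parallelize_prog hp rfl).symm.trans h
    | query S' nxt' =>
      obtain ⟨rfl, rfl⟩ := Instr.query.inj ((M.parallelize_prog hp rfl).symm.trans h)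
      rfl
    | step δ' => cases (M.parallelize_prog hp rfl).symm.trans h

open scoped Classical in
/-- The simulation relation between `M.const false` and `M.parallelize`, where `x` is the query to
the second oracle `B`. -/
def ParRel (B : Set Word) (x : Word) (c : (M.const false).Cfg) (c' : M.parallelize.Cfg) : Prop :=
  (c.state.2 = false ∧ c' = ⟨(c.state.1, none), c.tape, ![c.qtape (), x]⟩) ∨
    (c.state.2 = true ∧ c' = ⟨(c.state.1, some (decide (x ∈ B))), c.tape, ![c.qtape (), []]⟩)

theorem parRel_next {O : Fin 2 → Set Word} {x : Word} {c : (M.const false).Cfg}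
    {c' : M.parallelize.Cfg} (h : M.ParRel (O 1) x c c') (hc : ¬ (M.const false).Halted c) :
    M.ParRel (O 1) x ((M.const false).next (fun _ => O 0) true c) (M.parallelize.next O () c') := by
  classical
  cases hp : (M.const false).prog c.state with
  | halt a => exact absurd ⟨a, hp⟩ hc
  | query S nxt =>
    obtain ⟨rfl, hf, hnxt⟩ := M.const_query false hp
    obtain ⟨-, rfl⟩ | ⟨hf', -⟩ := h
    · have hp' : M.parallelize.prog (c.state.1, none) =
          .query Finset.univ fun a' => ((nxt fun _ => a' 0).1, some (a' 1)) :=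
        M.parallelize_prog (f := c.state.2) hp hf.symm
      rw [next_query _ hp, M.parallelize.next_query hp']
      refine Or.inr ⟨hnxt _, ?_⟩
      simp only [Finset.mem_univ, true_and, if_true]
      congr 1
      funext j
      fin_cases j <;> rfl
    · rw [hf] at hf'
      contradiction
  | step δ =>
    have hδ := M.const_step false hp
    have key : ∀ (o : Option Bool) (y : Word), o.isSome = c.state.2 →
        M.parallelize.next O () ⟨(c.state.1, o), c.tape, ![c.qtape (), y]⟩ =
        ⟨(((M.const false).next (fun _ => O 0) true c).state.1, o),
          ((M.const false).next (fun _ => O 0) true c).tape,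
          ![((M.const false).next (fun _ => O 0) true c).qtape (), y]⟩ := by
      intro o y ho
      have hp' : M.parallelize.prog (c.state.1, o) = .step fun h _ => (((δ h true).1.1, o),
          (δ h true).2.1, fun j => if j = 0 then (δ h true).2.2 () else none) :=
        M.parallelize_prog (f := c.state.2) hp ho
      rw [next_step _ hp, M.parallelize.next_step hp']
      simp only
      congr 1
      funext j
      fin_cases j <;> simp
    have hs : ((M.const false).next (fun _ => O 0) true c).state.2 = c.state.2 := by
      rw [next_step _ hp]
      exact (hδ _ _).2
    obtain ⟨hf, rfl⟩ | ⟨hf, rfl⟩ := h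
    · exact Or.inl ⟨hs.trans hf, key none x (by rw [hf]; rfl)⟩
    · exact Or.inr ⟨hs.trans hf, key _ [] (by rw [hf]; rfl)⟩

/-- If the first oracle was never asked, the second is still pending and costs one more step;
otherwise its answer is already in the state. -/
theorem parRel_halt {O : Fin 2 → Set Word} {x : Word} {c : (M.const false).Cfg}
    {c' : M.parallelize.Cfg} (h : M.ParRel (O 1) x c c') {a : Bool}
    (ha : (M.const false).prog c.state = .halt a) (v : Bool) :
    M.parallelize.HaltsIn O 1 c' ∧
      (M.parallelize.Yields O v c' ↔ ∃ b : Bool, (b = true ↔ x ∈ O 1) ∧ v = xor a b) := by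
  classical
  have e : (∃ b : Bool, (b = true ↔ x ∈ O 1) ∧ v = xor a b) ↔ v = xor a (decide (x ∈ O 1)) := by
    constructor
    · rintro ⟨b, hb, rfl⟩
      rw [← decide_eq_true_iff (p := x ∈ O 1), Bool.coe_iff_coe] at hb
      rw [hb]
    · rintro rfl
      exact ⟨_, decide_eq_true_iff, rfl⟩
  have hsome : ∀ (b : Bool) τ κ,
      M.parallelize.prog (Cfg.mk (M := M.parallelize) (c.state.1, some b) τ κ).state =
        .halt (xor a b) := by
    intro b τ κ
    exact M.parallelize_prog (o := some b) (M.const_halt false ha) rfl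
  rw [e]
  obtain ⟨hf, rfl⟩ | ⟨hf, rfl⟩ := h
  · have hp' : M.parallelize.prog (c.state.1, none) =
        .query {1} fun a' => (c.state.1, some (a' 1)) :=
      M.parallelize_prog (f := c.state.2) ha hf.symm
    have hn : ∀ b, M.parallelize.prog (M.parallelize.next O b
        ⟨(c.state.1, none), c.tape, ![c.qtape (), x]⟩).state =
        .halt (xor a (decide (x ∈ O 1))) := by
      intro b
      rw [M.parallelize.next_query hp', hsome]
      simp
    refine ⟨Or.inr fun b => ⟨_, hn b⟩, ?_⟩
    rw [Yields, endsIn_iff_next]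
    simp only [← Yields.eq_1, yields_of_halt _ (hn _), exists_const]
  · have h := hsome (decide (x ∈ O 1)) c.tape ![c.qtape (), []]
    exact ⟨Halted.haltsIn ⟨_, h⟩ 1, yields_of_halt _ h⟩

theorem parallelize_spec {O : Fin 2 → Set Word} {x : Word} {n : ℕ} {v : Bool}
    (hn : (M.const false).HaltsIn (fun _ => O 0) n ((M.const false).init x)) :
    M.parallelize.HaltsIn O (n + 1) (M.parallelize.multiInit ∅ {1} x) ∧
      (M.parallelize.Yields O v (M.parallelize.multiInit ∅ {1} x) ↔
        ∃ a, (M.const false).Yields (fun _ => O 0) a ((M.const false).init x) ∧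
          ∃ b : Bool, (b = true ↔ x ∈ O 1) ∧ v = xor a b) := by
  classical
  have hR : M.ParRel (O 1) x ((M.const false).init x) (M.parallelize.multiInit ∅ {1} x) := by
    refine Or.inl ⟨rfl, ?_⟩
    simp only [multiInit, init_eq, Set.mem_empty_iff_false, or_false]
    congr 1
    funext j
    fin_cases j <;> simp
  have h := simulate (M' := M.parallelize) (O' := O)
    (Z := fun c => M.parallelize.prog c.state = .halt v) (M.ParRel (O 1) x) 1 1
    (fun c => ∃ a, (M.const false).prog c.state = .halt a ∧
      ∃ b : Bool, (b = true ↔ x ∈ O 1) ∧ v = xor a b) ?_ hn hR ?_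
  · rw [endsIn_exists_halt _ (P := fun a => ∃ b : Bool, (b = true ↔ x ∈ O 1) ∧ v = xor a b),
      Nat.one_mul] at h
    exact h
  · intro c c' hR hc
    have key := M.parRel_next hR hc
    -- A deterministic machine can simulate one with binary choices here because the choices of
    -- `M.const false` have no effect.
    refine ⟨fun _ => ⟨true, _, 0, one_pos, rfl, key⟩, fun b => ⟨(), _, 0, one_pos, rfl, ?_⟩⟩
    rwa [const_next_eq]
  · rintro cf cf' ⟨a, ha⟩ - hR
    have h := M.parRel_halt hR ha v
    exact ⟨h.1, h.2.trans ⟨fun h => ⟨a, ha, h⟩,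
      fun ⟨a', ha', h⟩ => by rwa [Instr.halt.inj (ha.symm.trans ha')]⟩⟩

end Parallelize

/-! ### Asking one oracle after the other -/

section Serialize

variable (M : Machine (Fin 2) Unit)

/-- Simulate each step of `M` by two steps; ask the first oracle in the first and the second oracle
in the second of them. -/
abbrev serialize : Machine (Fin 2) Unit where
  Q := M.Q ⊕ (M.Q × Bool)
  K := M.K
  finQ := by have := M.finQ; infer_instance
  finK := M.finK
  start := .inl M.start
  inp := M.inp
  prog
    | .inl q =>
      match M.prog q with
      | .halt a => .halt a
      | .query S _ => .query (S.filter (· = 0)) fun a => .inr (q, a 0)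
      | .step _ => .step fun h _ => (.inr (q, false), fun k => (h k, none), fun _ => none)
    | .inr (q, b) =>
      match M.prog q with
      | .halt a => .halt a
      | .query S nxt => .query (S.filter (· = 1)) fun a => .inl (nxt ![b, a 1])
      | .step δ => .step fun h c => (.inl (δ h c).1, (δ h c).2)

/-- The configuration of `M.serialize` that corresponds to a configuration of `M`. -/
def serialCfg (c : M.Cfg) : M.serialize.Cfg := ⟨.inl c.state, c.tape, c.qtape⟩

theorem serialize_halt_iff (c : M.Cfg) (a : Bool) :
    M.serialize.prog (M.serialCfg c).state = .halt a ↔ M.prog c.state = .halt a := by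
  cases hp : M.prog c.state <;> simp [serialCfg, hp]

/-- Both halves act on the unchanged tapes of `c`: asking the first oracle erases only its own query
tape, and its answer is kept in the state. -/
theorem serialize_next_next (O : Fin 2 → Set Word) (b b' : Unit) (c : M.Cfg) :
    M.serialize.next O b' (M.serialize.next O b (M.serialCfg c)) =
      M.serialCfg (M.next O b' c) := by
  classical
  cases hp : M.prog c.state with
  | halt a =>
    have h := (M.serialize_halt_iff c a).2 hp
    rw [next_halt _ hp, next_halt _ h, next_halt _ h]
  | query S nxt =>
    have h : M.serialize.prog (M.serialCfg c).state =
        .query (S.filter (· = 0)) fun a => .inr (c.state, a 0) := by simp only [serialCfg, hp]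
    rw [next_query _ h, next_query (M := M.serialize) (S := S.filter (· = 1))
      (nxt := fun a => .inl (nxt ![decide (0 ∈ S ∧ c.qtape 0 ∈ O 0), a 1])) (by
        simp [serialCfg, hp]), next_query _ hp]
    simp only [serialCfg, Cfg.mk.injEq, Sum.inl.injEq, true_and]
    constructor
    · congr 1
      funext j
      fin_cases j <;> simp
    · funext j
      fin_cases j <;> simp
  | step δ =>
    have h : M.serialize.prog (M.serialCfg c).state = .step fun h _ =>
        (.inr (c.state, false), fun k => (h k, none), fun _ => none) := by
      simp only [serialCfg, hp]
    rw [next_step _ h, next_step (M := M.serialize) (δ := fun h c => (.inl (δ h c).1, (δ h c).2))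
      (by simp only [hp]), next_step _ hp]
    simp only [serialCfg, tapeAct_idle, Option.toList_none, List.append_nil]

theorem serialize_asks (c : M.Cfg) (i : Fin 2) :
    M.serialize.Asks (M.serialCfg c) i ↔ i = 0 ∧ M.Asks c 0 := by
  cases hp : M.prog c.state with
  | halt a => simp [Asks, serialCfg, hp]
  | query S nxt =>
    simp only [Asks, serialCfg, hp, Instr.query.injEq]
    constructor
    · rintro ⟨_, _, ⟨rfl, -⟩, h⟩
      rw [Finset.mem_filter] at h
      exact ⟨h.2, S, nxt, ⟨rfl, rfl⟩, h.2 ▸ h.1⟩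
    · rintro ⟨rfl, _, _, ⟨rfl, -⟩, h⟩
      exact ⟨_, _, ⟨rfl, rfl⟩, Finset.mem_filter.2 ⟨h, rfl⟩⟩
  | step δ => simp [Asks, serialCfg, hp]

theorem serialize_next_asks (O : Fin 2 → Set Word) (b : Unit) (c : M.Cfg) (i : Fin 2)
    (h : M.serialize.Asks (M.serialize.next O b (M.serialCfg c)) i) : i = 1 ∧ M.Asks c 1 := by
  obtain ⟨S, nxt, h, hi⟩ := h
  cases hp : M.prog c.state with
  | halt a =>
    have h' := (M.serialize_halt_iff c a).2 hp
    rw [next_halt _ h', h'] at h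
    cases h
  | query S' nxt' =>
    have h' : M.serialize.prog (M.serialCfg c).state =
        .query (S'.filter (· = 0)) fun a => .inr (c.state, a 0) := by simp only [serialCfg, hp]
    rw [next_query _ h'] at h
    simp only [hp, Instr.query.injEq] at h
    rw [← h.1, Finset.mem_filter] at hi
    exact ⟨hi.2, S', nxt', hp, hi.2 ▸ hi.1⟩
  | step δ =>
    have h' : M.serialize.prog (M.serialCfg c).state = .step fun h _ =>
        (.inr (c.state, false), fun k => (h k, none), fun _ => none) := by
      simp only [serialCfg, hp]
    rw [next_step _ h'] at h
    simp only [hp, reduceCtorEq] at h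

theorem serialize_run (O : Fin 2 → Set Word) (w : ℕ → Unit) (x : Word) (t : ℕ) :
    M.serialize.run O w x (2 * t) = M.serialCfg (M.run O w x t) := by
  induction t with
  | zero => rfl
  | succ t ih => rw [Nat.mul_succ, run, run, ih, serialize_next_next, run]

theorem serialize_asksAt {O : Fin 2 → Set Word} {w : ℕ → Unit} {x : Word} {s : ℕ} {i : Fin 2}
    (h : M.serialize.AsksAt O w x s i) : ∃ t, s = 2 * t + i ∧ M.AsksAt O w x t i := by
  obtain ⟨t, rfl | rfl⟩ := s.even_or_odd'
  · have h : M.serialize.Asks (M.serialize.run O w x (2 * t)) i := h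
    rw [serialize_run, serialize_asks] at h
    obtain ⟨rfl, h'⟩ := h
    exact ⟨t, rfl, h'⟩
  · have h : M.serialize.Asks (M.serialize.next O (w (2 * t)) (M.serialize.run O w x (2 * t))) i := h
    rw [serialize_run] at h
    obtain ⟨rfl, h'⟩ := M.serialize_next_asks _ _ _ _ h
    exact ⟨t, rfl, h'⟩

theorem serialize_polyTime (hM : M.PolyTime) : M.serialize.PolyTime := by
  obtain ⟨p, hp⟩ := hM
  refine ⟨2 * p, fun O w x => ?_⟩
  obtain ⟨t, ht, a, ha⟩ := hp O w x
  refine ⟨2 * t, by simpa using ht, a, ?_⟩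
  rwa [serialize_run, serialize_halt_iff]

theorem serialize_lang (O : Fin 2 → Set Word) : M.serialize.lang O = M.lang O := by
  ext x
  constructor
  · rintro ⟨w, s, h⟩
    obtain ⟨t, rfl | rfl⟩ := s.even_or_odd'
    · rw [serialize_run, serialize_halt_iff] at h
      exact ⟨w, t, h⟩
    · have h2 : M.serialize.run O w x (2 * (t + 1)) = M.serialize.run O w x (2 * t + 1) :=
        next_halt _ h
      rw [← h2, serialize_run, serialize_halt_iff] at h
      exact ⟨w, t + 1, h⟩
  · rintro ⟨w, t, h⟩
    exact ⟨w, 2 * t, by rwa [serialize_run, serialize_halt_iff]⟩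

end Serialize

/-! ### Exchanging the oracles -/

section Swap

variable (M : Machine (Fin 2) Unit)

/-- The machine `M` with its two oracles exchanged. -/
abbrev swap : Machine (Fin 2) Unit where
  Q := M.Q
  K := M.K
  finQ := M.finQ
  finK := M.finK
  start := M.start
  inp := M.inp
  prog q :=
    match M.prog q with
    | .halt a => .halt a
    | .query S nxt => .query (S.image Fin.rev) fun a => nxt (a ∘ Fin.rev)
    | .step δ => .step fun h c => ((δ h c).1, (δ h c).2.1, (δ h c).2.2 ∘ Fin.rev)

/-- The configuration of `M.swap` that corresponds to a configuration of `M`. -/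
def swapCfg (c : M.Cfg) : M.swap.Cfg := ⟨c.state, c.tape, c.qtape ∘ Fin.rev⟩

theorem mem_image_rev {S : Finset (Fin 2)} {i : Fin 2} : i ∈ S.image Fin.rev ↔ i.rev ∈ S := by
  rw [Finset.mem_image]
  exact ⟨fun ⟨j, hj, h⟩ => by rwa [← h, Fin.rev_rev], fun h => ⟨_, h, Fin.rev_rev i⟩⟩

theorem swap_halt_iff (c : M.Cfg) (a : Bool) :
    M.swap.prog (M.swapCfg c).state = .halt a ↔ M.prog c.state = .halt a := by
  cases hp : M.prog c.state <;> simp [swapCfg, hp]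

theorem swap_next (O : Fin 2 → Set Word) (b : Unit) (c : M.Cfg) :
    M.swap.next (O ∘ Fin.rev) b (M.swapCfg c) = M.swapCfg (M.next O b c) := by
  classical
  cases hp : M.prog c.state with
  | halt a => rw [next_halt _ hp, next_halt _ ((M.swap_halt_iff c a).2 hp)]
  | query S nxt =>
    have h : M.swap.prog (M.swapCfg c).state =
        .query (S.image Fin.rev) fun a => nxt (a ∘ Fin.rev) := by simp only [swapCfg, hp]
    rw [next_query _ hp, next_query _ h]
    simp only [mem_image_rev, swapCfg, comp_def, Fin.rev_rev]
    congr!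
  | step δ =>
    have h : M.swap.prog (M.swapCfg c).state = .step fun h c =>
        ((δ h c).1, (δ h c).2.1, (δ h c).2.2 ∘ Fin.rev) := by simp only [swapCfg, hp]
    rw [next_step _ hp, next_step _ h]
    rfl

theorem swap_run (O : Fin 2 → Set Word) (w : ℕ → Unit) (x : Word) (t : ℕ) :
    M.swap.run (O ∘ Fin.rev) w x t = M.swapCfg (M.run O w x t) := by
  induction t with
  | zero => rfl
  | succ t ih => rw [run, ih, swap_next, run]

theorem swap_asksAt {O : Fin 2 → Set Word} {w : ℕ → Unit} {x : Word} {t : ℕ} {i : Fin 2} :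
    M.swap.AsksAt (O ∘ Fin.rev) w x t i ↔ M.AsksAt O w x t i.rev := by
  rw [AsksAt, swap_run, AsksAt]
  cases hp : M.prog (M.run O w x t).state with
  | halt a => simp [swapCfg, hp]
  | query S nxt =>
    simp only [swapCfg, hp, Instr.query.injEq]
    constructor
    · rintro ⟨_, _, ⟨rfl, -⟩, h⟩
      exact ⟨S, nxt, ⟨rfl, rfl⟩, mem_image_rev.1 h⟩
    · rintro ⟨_, _, ⟨rfl, -⟩, h⟩
      exact ⟨_, _, ⟨rfl, rfl⟩, mem_image_rev.2 h⟩
  | step δ => simp [swapCfg, hp]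

theorem swap_polyTime (hM : M.PolyTime) : M.swap.PolyTime := by
  obtain ⟨p, hp⟩ := hM
  refine ⟨p, fun O w x => ?_⟩
  obtain ⟨t, ht, a, ha⟩ := hp (O ∘ Fin.rev) w x
  refine ⟨t, ht, a, ?_⟩
  have := M.swap_run (O ∘ Fin.rev) w x t
  rw [comp_assoc, Fin.rev_involutive.comp_self, comp_id] at this
  rwa [this, swap_halt_iff]

theorem swap_lang (O : Fin 2 → Set Word) : M.swap.lang (O ∘ Fin.rev) = M.lang O := by
  ext x
  exact exists₂_congr fun w t => by rw [swap_run]; exact M.swap_halt_iff _ _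

end Swap

end Machine

end QueryOrder

namespace QueryOrder

open Function Turing

namespace Machine

/-! ### Deciding whether the query to the second oracle is answered positively -/

section SecondQuery

variable (M : Machine (Fin 2) Unit)

/-- The time of the first query is unique, so the word depends on `x` alone; without a query any
word serves. A query cannot come after halting, and a query tape gains at most one bit per step,
hence the length bound. -/
theorem exists_query_word {O : Fin 2 → Set Word} {n : ℕ} {x : Word}
    (hn : M.HaltsIn O n (M.init x)) :
    ∃ y : Word, y.length ≤ n ∧
      ∀ s, M.FirstAsk O (M.init x) s → (M.run O (fun _ => ()) x s).qtape 1 = y := by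
  by_cases h : ∃ s, M.FirstAsk O (M.init x) s
  · obtain ⟨s, hs⟩ := h
    refine ⟨(M.run O (fun _ => ()) x s).qtape 1, ?_, fun s' hs' => ?_⟩
    · refine (M.length_qtape_le O _ x s 1).trans ?_
      by_contra! hlt
      obtain ⟨t, ht, h⟩ := M.haltsIn_iff.1 hn fun _ => ()
      have : ∀ k, M.runFrom O (fun _ => ()) (M.init x) (t + k) =
          M.runFrom O (fun _ => ()) (M.init x) t := by
        intro k
        induction k with
        | zero => rfl
        | succ k ih => rw [← Nat.add_assoc, runFrom, ih, h.next_eq]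
      obtain ⟨k, rfl⟩ := Nat.exists_eq_add_of_le (ht.trans hlt.le)
      have hs1 := hs.1
      rw [this k] at hs1
      exact h.not_asks 1 hs1
    · have : s' = s := le_antisymm (not_lt.1 fun h => hs'.2 _ h hs.1)
        (not_lt.1 fun h => hs.2 _ h hs'.1)
      rw [this]
  · exact ⟨[], Nat.zero_le _, fun s hs => absurd ⟨s, hs⟩ h⟩

/-- With an oracle for the disjoint union of `A` and `D`, decide whether `M`, with `A` as first
oracle, asks the second oracle, and the first query is accepted by `N` with oracle `D`. -/
noncomputable abbrev secondQuery (N : Machine Unit Bool) : Machine Unit Bool :=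
  comp (M.probe.tag false) none (N.tag true)

/-- The time bound adds up the tagged probe, the tagged `N` on a word of length at most `p`, the
rewinding of that word, and the step that clears the query tape. The set `B` is arbitrary, as its
answers do not influence the first query. -/
theorem secondQuery_spec {N : Machine Unit Bool} {p q : Polynomial ℕ}
    (hM : ∀ O x, M.HaltsIn O (p.eval x.length) (M.init x))
    (hN : ∀ O x, N.HaltsIn O (q.eval x.length) (N.init x)) (E : Unit → Set Word) (B : Set Word)
    (x : Word) :
    (M.secondQuery N).HaltsIn E ((2 * p + 1 + (2 * q.comp p + 1 + (p + 2) + 1)).eval x.length)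
        ((M.secondQuery N).init x) ∧
      (x ∈ (M.secondQuery N).lang E ↔
        ∃ s, M.FirstAsk ![{x | false :: x ∈ E ()}, B] (M.init x) s ∧
          (M.run ![{x | false :: x ∈ E ()}, B] (fun _ => ()) x s).qtape 1 ∈
            N.lang fun i => {x | true :: x ∈ E i}) := by
  set O : Fin 2 → Set Word := ![{x | false :: x ∈ E ()}, B] with hO
  have hO0 : (fun _ : Unit => O 0) = fun i => {x | false :: x ∈ E i} := rfl
  obtain ⟨y, hy, hys⟩ := M.exists_query_word (hM O x)
  have hp := fun Z => M.probe_spec (hM O x) Z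
  simp only [hO0, ← probe_init] at hp
  have hG := fun Z => M.probe.tag_spec false (O := E) (Z := Z) (hp fun _ => True).1
  -- Every accepting computation of the probe stops at the unique first query, with `y` on the extra
  -- tape.
  have hout : ∀ cf, (M.probe.tag false).EndsIn E (· = cf) ((M.probe.tag false).init x) →
      (M.probe.tag false).prog cf.state = .halt true → cf.tape none = wordTape y.reverse [] := by
    intro cf hcf hacc
    rw [(hG _).2] at hcf
    have h1 : M.probe.EndsIn (fun i => {x | false :: x ∈ E i})
        (fun c => M.probe.prog c.state = .halt true ∧ M.probe.tagCfg false c = cf)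
        (M.probe.init x) := by
      refine hcf.imp fun c _ hc => ⟨?_, hc⟩
      rwa [← M.probe.tag_halt_iff false c true, hc]
    rw [(hp _).2] at h1
    obtain ⟨s, hs, rfl⟩ := h1
    rw [← hys s hs, ← runFrom_init]
    rfl
  have hNy := (N.tag_spec true (O := E) (Z := fun _ => True) (hN _ y)).1
  have h := comp_spec (M.probe.tag false) none (N.tag true) (hG fun _ => True).1 hNy hout
  constructor
  · refine h.1.mono ?_
    have := eval_monotone q hy
    simp only [Polynomial.eval_add, Polynomial.eval_mul, Polynomial.eval_ofNat,
      Polynomial.eval_one, Polynomial.eval_comp] at this ⊢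
    omega
  · rw [h.2]
    have h1 : x ∈ (M.probe.tag false).lang E ↔ ∃ s, M.FirstAsk O (M.init x) s := by
      rw [mem_lang_iff, M.probe.tag_yields false (hp fun _ => True).1]
      have := (hp fun _ => True).2
      simp only [and_true] at this
      exact this
    have h2 : y ∈ (N.tag true).lang E ↔ y ∈ N.lang fun i => {x | true :: x ∈ E i} := by
      rw [mem_lang_iff, N.tag_yields true (hN _ y), mem_lang_iff]
    rw [h1, h2, ← exists_and_right]
    exact exists_congr fun s => and_congr_right fun hs => by rw [hys s hs]

/-- At most one query to the second oracle is made, so any query is the first. -/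
theorem exists_firstAsk_iff {A B : Set Word} (hM : M.AtMostOneEach ![A, B]) (x : Word) :
    (∃ s, M.FirstAsk ![A, B] (M.init x) s ∧ (M.run ![A, B] (fun _ => ()) x s).qtape 1 ∈ B) ↔
      ∃ s, M.AsksAt ![A, B] (fun _ => ()) x s 1 ∧
        (M.run ![A, B] (fun _ => ()) x s).qtape 1 ∈ B := by
  refine exists_congr fun s => and_congr_left fun _ => ?_
  simp only [FirstAsk, runFrom_init]
  refine ⟨fun h => h.1, fun h => ⟨h, fun s' hlt hs' => hlt.ne ?_⟩⟩
  exact hM _ x 1 s' s hs' h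

end SecondQuery

end Machine

/-! ### Comparison of the query classes -/

/-- Languages decided with at most one query to each of two oracles, without restriction on the
order of these queries. -/
def POneEach (C D : ComplexityClass) : ComplexityClass :=
  {L | ∃ A ∈ C, ∃ B ∈ D, ∃ M : DPTM, M.AtMostOneEach ![A, B] ∧ L = M.lang ![A, B]}

theorem POrdered_subset_PArbitrary (C D : ComplexityClass) : POrdered C D ⊆ PArbitrary C D := by
  rintro L ⟨A, hA, B, hB, M, hM, h⟩
  exact ⟨A, hA, B, hB, M, ⟨hM.1, fun w x t t' h0 h1 => (hM.2 w x t t' h0 h1).ne⟩, h⟩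

theorem PArbitrary_subset_POneEach (C D : ComplexityClass) : PArbitrary C D ⊆ POneEach C D := by
  rintro L ⟨A, hA, B, hB, M, hM, h⟩
  exact ⟨A, hA, B, hB, M, hM.1, h⟩

/-- Queries asked together in step `t` are asked by `serialize` in steps `2 * t` and `2 * t + 1`,
the first oracle first. -/
theorem PParallel_subset_POrdered (C D : ComplexityClass) : PParallel C D ⊆ POrdered C D := by
  rintro L ⟨A, hA, B, hB, M, hM, rfl⟩
  refine ⟨A, hA, B, hB, ⟨M.serialize, M.serialize_polyTime M.polyTime⟩, ⟨?_, ?_⟩,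
    (M.serialize_lang _).symm⟩
  · intro w x i s s' h h'
    obtain ⟨t, rfl, ht⟩ := M.serialize_asksAt h
    obtain ⟨t', rfl, ht'⟩ := M.serialize_asksAt h'
    rw [hM w x t t' i i ht ht']
  · intro w x s s' h h'
    obtain ⟨t, rfl, ht⟩ := M.serialize_asksAt h
    obtain ⟨t', rfl, ht'⟩ := M.serialize_asksAt h'
    rw [hM w x t t' 0 1 ht ht']
    simp

theorem cons_comp_rev {α : Type*} (a b : α) : ![a, b] ∘ Fin.rev = ![b, a] := by
  funext i
  fin_cases i <;> rfl

theorem POneEach_comm (C D : ComplexityClass) : POneEach C D = POneEach D C := by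
  have key : ∀ C D, POneEach C D ⊆ POneEach D C := by
    rintro C D L ⟨A, hA, B, hB, M, hM, rfl⟩
    refine ⟨B, hB, A, hA, ⟨M.swap, M.swap_polyTime M.polyTime⟩, ?_, ?_⟩
    · intro w x i t t' h h'
      rw [← cons_comp_rev, Machine.swap_asksAt] at h h'
      exact hM w x _ t t' h h'
    · rw [← cons_comp_rev A B]
      exact (M.swap_lang _).symm
  exact (key C D).antisymm (key D C)

theorem PParallel_comm (C D : ComplexityClass) : PParallel C D = PParallel D C := by
  have key : ∀ C D, PParallel C D ⊆ PParallel D C := by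
    rintro C D L ⟨A, hA, B, hB, M, hM, rfl⟩
    refine ⟨B, hB, A, hA, ⟨M.swap, M.swap_polyTime M.polyTime⟩, ?_, ?_⟩
    · intro w x t t' i i' h h'
      rw [← cons_comp_rev, Machine.swap_asksAt] at h h'
      exact hM w x t t' _ _ h h'
    · rw [← cons_comp_rev A B]
      exact (M.swap_lang _).symm
  exact (key C D).antisymm (key D C)

/-- The query to `B` is the input itself; `prep` puts it on the second query tape beforehand, so it
is ready when `A` is asked. -/
theorem mem_PParallel {C D : ComplexityClass} {A B : Set Word} (hA : A ∈ C) (hB : B ∈ D)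
    (M : DPTM) (L : Set Word)
    (hL : ∀ x, x ∈ L ↔ ∃ a, (M.const false).Yields (fun _ => A) a ((M.const false).init x) ∧
      ∃ b : Bool, (b = true ↔ x ∈ B) ∧ true = xor a b) : L ∈ PParallel C D := by
  obtain ⟨p, hp⟩ := (Machine.polyTime_iff _).1 (M.const_polyTime false M.polyTime)
  have h := fun (O : Fin 2 → Set Word) x => M.parallelize_spec (O := O) (v := true) (hp _ x)
  have h' := fun O x => M.parallelize.prep_spec ∅ {1} (v := true) (h O x).1
  refine ⟨A, hA, B, hB, ⟨M.parallelize.prep ∅ {1}, ?_⟩, ?_, ?_⟩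
  · rw [Machine.polyTime_iff]
    refine ⟨p + 1 + (2 * .X + 3), fun O x => ?_⟩
    simpa using (h' O x).1
  · intro w x t t' i i' hi hi'
    exact (M.parallelize_once.prep ∅ {1}).eq_of_asksAt hi hi'
  · ext x
    rw [hL, Machine.mem_lang_iff, (h' _ x).2, (h _ x).2]
    rfl

/-- The second oracle is replaced by `W`, which tells whether the verdict obtained with negative
answers must be flipped. -/
theorem POneEach_sigma_subset_PParallel {j k : ℕ} (hjk : j < k) :
    POneEach (sigma j) (sigma k) ⊆ PParallel (sigma j) (sigma k) := by
  rintro L ⟨A, hA, B, hB, M, hM, rfl⟩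
  obtain ⟨m, rfl⟩ : ∃ m, k = m + 1 := ⟨k - 1, by omega⟩
  obtain ⟨D, hD, N, hN, rfl⟩ := hB
  -- This is where `j < k` matters: `A` lies low enough to be merged with the oracle `D` underlying
  -- `B`.
  have hE := join_mem_sigma m (sigma_mono (Nat.le_of_lt_succ hjk) hA) hD
  set E := Machine.join A D
  have hEA : {x | false :: x ∈ E} = A := by
    ext x
    exact Machine.false_cons_mem_join
  have hED : {x | true :: x ∈ E} = D := by
    ext x
    exact Machine.true_cons_mem_join
  have hc := fun i => M.const_polyTime i M.polyTime
  have ht := fun i => (M.const i).tag_polyTime false (hc i)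
  have hX := Machine.both_polyTime xor _ _ (ht false) (ht true)
  obtain ⟨p, hp⟩ := (Machine.polyTime_iff _).1 M.polyTime
  obtain ⟨q, hq⟩ := (Machine.polyTime_iff _).1 hN
  have hR := fun O x => M.secondQuery_spec hp hq O (N.lang fun _ => D) x
  have hRp : (M.secondQuery N).PolyTime := (Machine.polyTime_iff _).2 ⟨_, fun O x => (hR O x).1⟩
  have hB' := Machine.both_polyTime and _ _ hX hRp
  -- This language is `W`. The part that is compared by `xor` is deterministic; the nondeterministic
  -- machine enters only through `and`.
  have hW : (Machine.both and (Machine.both xor ((M.const false).tag false)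
      ((M.const true).tag false)) (M.secondQuery N)).lang (fun _ => E) ∈ sigma (m + 1) :=
    ⟨E, hE, _, hB', rfl⟩
  refine mem_PParallel hA hW M _ fun x => ?_
  have hmem : x ∈ (M.secondQuery N).lang (fun _ => E) ↔
      ∃ s, M.AsksAt ![A, N.lang fun _ => D] (fun _ => ()) x s 1 ∧
        (M.run ![A, N.lang fun _ => D] (fun _ => ()) x s).qtape 1 ∈ N.lang fun _ => D := by
    rw [(hR _ x).2]
    simp only [hEA, hED]
    exact M.exists_firstAsk_iff hM x
  have hu : ∀ i, ∃ a, ∀ v, (M.const i).Yields (fun _ => A) v ((M.const i).init x) ↔ v = a :=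
    fun i => by
      obtain ⟨r, hr⟩ := (Machine.polyTime_iff _).1 (hc i)
      exact M.const_yields_unique i (hr _ x)
  obtain ⟨a₀, h₀⟩ := hu false
  obtain ⟨a₁, h₁⟩ := hu true
  have htag : ∀ i v, ((M.const i).tag false).Yields (fun _ => E) v
      (((M.const i).tag false).init x) ↔
      (M.const i).Yields (fun _ => A) v ((M.const i).init x) := fun i v => by
    obtain ⟨r, hr⟩ := (Machine.polyTime_iff _).1 (hc i)
    rw [(M.const i).tag_yields false (hr _ x)]
    simp only [hEA]
  have hBx : x ∈ (Machine.both and (Machine.both xor ((M.const false).tag false)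
      ((M.const true).tag false)) (M.secondQuery N)).lang (fun _ => E) ↔
      xor a₀ a₁ = true ∧ x ∈ (M.secondQuery N).lang fun _ => E := by
    rw [Machine.mem_lang_iff, Machine.mem_lang_iff, Machine.both_yields and _ _ hX hRp]
    simp only [Machine.both_yields xor _ _ (ht false) (ht true), htag, h₀, h₁, exists_eq_left]
    constructor
    · rintro ⟨a, ha, h⟩
      rw [eq_comm, Bool.and_eq_true] at h
      obtain ⟨h1, rfl⟩ := h
      exact ⟨h1, ha⟩
    · rintro ⟨h1, h2⟩
      exact ⟨true, h2, by rw [h1]; rfl⟩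
  simp only [h₀, exists_eq_left, hBx]
  have hlang : ∀ i, (∀ t, M.AsksAt ![A, N.lang fun _ => D] (fun _ => ()) x t 1 →
      ((M.run ![A, N.lang fun _ => D] (fun _ => ()) x t).qtape 1 ∈ (N.lang fun _ => D) ↔
        i = true)) →
      (x ∈ M.lang ![A, N.lang fun _ => D] ↔
        (M.const i).Yields (fun _ => A) true ((M.const i).init x)) := fun i hi => by
    rw [← M.mem_const_lang i hM fun w t => hi t, Machine.mem_lang_iff]
    rfl
  by_cases hb : x ∈ (M.secondQuery N).lang fun _ => E
  · obtain ⟨s, hs, hs'⟩ := hmem.1 hb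
    -- The only query to the second oracle is answered positively, so the verdict is `a₁`, which
    -- equals `a₀ xor (a₀ xor a₁)`.
    rw [hlang true fun t ht => by rw [hM _ x 1 t s ht hs]; simpa using hs', h₁]
    simp only [hb, and_true, Bool.coe_iff_coe]
    cases a₀ <;> cases a₁ <;> simp
  -- The query is answered negatively or never made; then the verdict is `a₀` and `x` is not in `W`.
  · rw [hlang false fun t ht => by
      simpa using fun h => hb (hmem.2 ⟨t, ht, h⟩), h₀]
    simp [hb]

theorem PParallel_sigma_eq {j k : ℕ} (hjk : j ≠ k) :
    PParallel (sigma j) (sigma k) = POneEach (sigma j) (sigma k) := by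
  refine (((PParallel_subset_POrdered _ _).trans (POrdered_subset_PArbitrary _ _)).trans
    (PArbitrary_subset_POneEach _ _)).antisymm ?_
  obtain h | h := hjk.lt_or_gt
  · exact POneEach_sigma_subset_PParallel h
  · rw [POneEach_comm, PParallel_comm]
    exact POneEach_sigma_subset_PParallel h

theorem POrdered_sigma_eq {j k : ℕ} (hjk : j ≠ k) :
    POrdered (sigma j) (sigma k) = POneEach (sigma j) (sigma k) :=
  ((POrdered_subset_PArbitrary _ _).trans (PArbitrary_subset_POneEach _ _)).antisymm
    ((PParallel_sigma_eq hjk).superset.trans (PParallel_subset_POrdered _ _))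

theorem PArbitrary_sigma_eq {j k : ℕ} (hjk : j ≠ k) :
    PArbitrary (sigma j) (sigma k) = POneEach (sigma j) (sigma k) :=
  (PArbitrary_subset_POneEach _ _).antisymm
    ((POrdered_sigma_eq hjk).superset.trans (POrdered_subset_PArbitrary _ _))

end QueryOrder

theorem corollaryc :
    (∀ j k : ℕ,
      QueryOrder.POrdered (QueryOrder.sigma j) (QueryOrder.sigma k) =
        QueryOrder.POrdered (QueryOrder.sigma k) (QueryOrder.sigma j)) ∧
    (∀ j k : ℕ, j ≠ k →
      QueryOrder.PParallel (QueryOrder.sigma j) (QueryOrder.sigma k) =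
          QueryOrder.POrdered (QueryOrder.sigma j) (QueryOrder.sigma k) ∧
        QueryOrder.POrdered (QueryOrder.sigma j) (QueryOrder.sigma k) =
          QueryOrder.PArbitrary (QueryOrder.sigma j) (QueryOrder.sigma k)) := by
  refine ⟨fun j k => ?_, fun j k hjk => ⟨?_, ?_⟩⟩
  · obtain rfl | hjk := eq_or_ne j k
    · rfl
    · rw [QueryOrder.POrdered_sigma_eq hjk, QueryOrder.POrdered_sigma_eq hjk.symm,
        QueryOrder.POneEach_comm]
  · rw [QueryOrder.PParallel_sigma_eq hjk, QueryOrder.POrdered_sigma_eq hjk]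
  · rw [QueryOrder.POrdered_sigma_eq hjk, QueryOrder.PArbitrary_sigma_eq hjk]
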